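/- Let $M\in\mathbb N_0$ and let $\xi^{(k)}_m$ ($m,k\ge 1$) be $\mathbb N_0$-valued random variables on a probability space such that (i) the random quantities $(\xi^{(k)}_1,\dots,\xi^{(k)}_M)$ ($k\ge1$) and $\xi^{(k)}_m$ ($m>M$, $k\ge 1$) are independent; (ii) the random vectors $(\xi^{(k)}_1,\dots,\xi^{(k)}_M)$, $k\ge 1$, are identically distributed, are equal to the zero vector with positive probability, and have a finite fourth moment; (iii) for all $m>M$ and $k\ge 1$, $\xi^{(k)}_m$ is geometrically distributed with parameter $1/2$ and mean $1$, i.e. $P[\xi^{(k)}_m=j]=2^{-j-1}$ for $j\ge 0$. Put $\delta:=E\big[\sum_{m=1}^M(\xi^{(1)}_m-1)\big]$. For $n\in\mathbb N_0$ let $V=(V_k)_{k\ge 0}$ be the (forward branching) process started at $n$, that is, $V_0:=n$ and $V_{k+1}:=\sum_{m=1}^{V_k}\xi^{(k+1)}_m$ for $k\ge 0$, and let $h(n):=P_n[\sigma_0^V<\infty]$ be its extinction probability, where $\sigma_0^V:=\inf\{k\ge 0: V_k\le 0\}$ with $\inf\emptyset:=\infty$. If $\delta>1$, then there is a constant $c\in(0,\infty)$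 such that $$\lim_{n\to\infty} n^{\delta-1}h(n)=c.$$ -/

import Mathlib

open MeasureTheory ProbabilityTheory Filter Topology

noncomputable section

/-- The parameter `1/2` of the geometric distribution, as a point of the unit interval. -/
def halfParam : unitInterval := ⟨1 / 2, by norm_num, by norm_num⟩

/-- The forward branching process started from `n` individuals. Individuals and generations are
numbered from `0`: `ξ k m` is the number of children of the `m`-th individual of generation `k`
(if there is such an individual), so that `V_{k+1} = ∑_{m < V_k} ξ k m`. -/
def forwardBP {Ω : Type*} (ξ : ℕ → ℕ → Ω → ℕ) (n : ℕ) : ℕ → Ω → ℕ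
  | 0, _ => n
  | k + 1, ω => ∑ m ∈ Finset.range (forwardBP ξ n k ω), ξ k m ω

/-- The offspring vector of the first `M` individuals of generation `k`. -/
def firstOffspring {Ω : Type*} (M : ℕ) (ξ : ℕ → ℕ → Ω → ℕ) (k : ℕ) (ω : Ω) : Fin M → ℕ :=
  fun m => ξ k m ω

/-- The σ-algebras generated by the random quantities that are required to be independent:
the vector of the first `M` offspring variables of generation `k` (index `inl k`), and
the single variable `ξ k (M + j)` (index `inr (k, j)`). -/
abbrev offspringSigma {Ω : Type*} (M : ℕ) (ξ : ℕ → ℕ → Ω → ℕ) : ℕ ⊕ (ℕ × ℕ) → MeasurableSpace Ω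
  | Sum.inl k => MeasurableSpace.comap (firstOffspring M ξ k) inferInstance
  | Sum.inr (k, j) => MeasurableSpace.comap (ξ k (M + j)) inferInstance

/-- The assumptions on the offspring variables of the forward branching process. -/
structure IsForwardOffspring {Ω : Type*} [MeasurableSpace Ω] (μ : Measure Ω) (M : ℕ)
    (ξ : ℕ → ℕ → Ω → ℕ) : Prop where
  measurable : ∀ k m, Measurable (ξ k m)
  indep : iIndep (offspringSigma M ξ) μ
  identDistrib : ∀ k, IdentDistrib (firstOffspring M ξ k) (firstOffspring M ξ 0) μ μ
  vanish_pos : 0 < μ {ω | firstOffspring M ξ 0 ω = 0}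
  fourth_moment : ∀ m < M, Integrable (fun ω => (ξ 0 m ω : ℝ) ^ 4) μ
  geometric : ∀ k m, M ≤ m → HasLaw (ξ k m) (geometricMeasure halfParam) μ

/-- The drift parameter `δ = E[∑_{m < M} (ξ 0 m - 1)]`. -/
def driftParam {Ω : Type*} [MeasurableSpace Ω] (μ : Measure Ω) (M : ℕ)
    (ξ : ℕ → ℕ → Ω → ℕ) : ℝ :=
  ∫ ω, ∑ m ∈ Finset.range M, ((ξ 0 m ω : ℝ) - 1) ∂μ

/-- The entrance time `inf {k : f k ≤ y}` of a sequence into `(-∞, y]`, with `inf ∅ = ∞`. -/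
def entranceTime (f : ℕ → ℕ) (y : ℕ) : ℕ∞ := ⨅ (k : ℕ) (_ : f k ≤ y), (k : ℕ∞)

/-- The extinction probability `h(n) = P_n[σ_0^V < ∞]`. -/
def extinctionProb {Ω : Type*} [MeasurableSpace Ω] (μ : Measure Ω)
    (ξ : ℕ → ℕ → Ω → ℕ) (n : ℕ) : ℝ :=
  μ.real {ω | entranceTime (fun k => forwardBP ξ n k ω) 0 < ⊤}

end

/-!
Let `κ v` be the law of the number of children of `v` individuals. Since all individuals from number
`M` on have geometric offspring, `κ v` has, for `v ≥ M`, the generating function `G(z) f(z)^v` with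
`f(z) = 1/(2 - z)` and `G(z) = 1 - δ(1 - z) + O(|1 - z|²)`. The iterates of `f` are explicit Möbius
maps, and composing gives the Green series `g_v(s) = ∑_k (∏_{i<k} G(f_i(s))) f_k(s)^v`, which solves
`∫ g_w(s) dκ_v(w) = g_v(s) - s^v` for `v ≥ M`. Because `∏_{i<k} G(f_i(s))` is of order `k^{-δ}` and
`1 - f_k(s) ~ 1/k`, the series is a Riemann sum up to the factor `n^{1-δ}`: `n^{δ-1} g_n(s)`
converges. Its Taylor coefficients `W_j` at `s = 0`, `j < M`, are therefore harmonic for `κ` at all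
states `v ≥ M` and decay like `n^{1-δ}`.

The harmonicity conditions at `0 < v < M` and the boundary value at `0` form a square linear system
for the coefficients of a combination of the `W_j`; the maximum principle makes it injective, hence
solvable. The solution `u` with `u(0) = 1` is harmonic at all `v > 0` and satisfies
`n^{δ-1} u(n) → c`, where `c > 0` by comparison with `g_n(0)`. The forward process is either
absorbed at `0` or escapes to infinity, so the bounded martingale `u(V_k)` identifies `u` with the
extinction probability.
-/

noncomputable section

theorem map_natFloor_mul_volume_Ioi {t : ℝ} (ht : 0 < t) :
    (volume.restrict (Set.Ioi (0 : ℝ))).map (fun x => ⌊t * x⌋₊) =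
      (ENNReal.ofReal t)⁻¹ • Measure.count := by
  have hmeas : Measurable fun x : ℝ => ⌊t * x⌋₊ :=
    Nat.measurable_floor.comp (measurable_const_mul t)
  refine Measure.ext_of_singleton fun k => ?_
  have hfiber : (fun x : ℝ => ⌊t * x⌋₊) ⁻¹' {k} ∩ Set.Ici 0 = Set.Ico (k / t) ((k + 1) / t) := by
    ext x
    simp only [Set.mem_inter_iff, Set.mem_preimage, Set.mem_singleton_iff, Set.mem_Ici,
      Set.mem_Ico, div_le_iff₀ ht, lt_div_iff₀ ht, mul_comm x t]
    constructor
    · rintro ⟨hfloor, hx⟩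
      exact (Nat.floor_eq_iff (by positivity)).1 hfloor
    · intro h
      have htx : 0 ≤ t * x := k.cast_nonneg.trans h.1
      exact ⟨(Nat.floor_eq_iff htx).2 h, nonneg_of_mul_nonneg_right htx ht⟩
  rw [restrict_Ioi_eq_restrict_Ici, Measure.map_apply hmeas (measurableSet_singleton k),
    Measure.restrict_apply (hmeas (measurableSet_singleton k)), hfiber, Real.volume_Ico,
    Measure.smul_apply, Measure.count_singleton, ← sub_div, add_sub_cancel_left, one_div,
    ENNReal.ofReal_inv_of_pos ht, smul_eq_mul, mul_one]

section RiemannSum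

variable {E : Type*} [NormedAddCommGroup E]

theorem stronglyMeasurable_comp_natFloor_mul (a : ℕ → E) (t : ℝ) :
    StronglyMeasurable fun x : ℝ => a ⌊t * x⌋₊ :=
  (StronglyMeasurable.of_discrete (f := a)).comp_measurable
    (Nat.measurable_floor.comp (measurable_const_mul t))

variable [NormedSpace ℝ E] [CompleteSpace E]

theorem integral_comp_natFloor_mul_Ioi {a : ℕ → E} {t : ℝ} (ht : 0 < t)
    (ha : IntegrableOn (fun x => a ⌊t * x⌋₊) (Set.Ioi 0)) :
    ∫ x in Set.Ioi (0 : ℝ), a ⌊t * x⌋₊ = t⁻¹ • ∑' k, a k := by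
  have hmeas : AEMeasurable (fun x : ℝ => ⌊t * x⌋₊) (volume.restrict (Set.Ioi 0)) :=
    (Nat.measurable_floor.comp (measurable_const_mul t)).aemeasurable
  have hsm := StronglyMeasurable.of_discrete (f := a)
  have hint : Integrable a ((ENNReal.ofReal t)⁻¹ • Measure.count) := by
    rw [← map_natFloor_mul_volume_Ioi ht]
    exact (integrable_map_measure hsm.aestronglyMeasurable hmeas).2 ha
  rw [← integral_map hmeas hsm.aestronglyMeasurable, map_natFloor_mul_volume_Ioi ht,
    integral_countable hint, ← tsum_const_smul'']
  simp [measureReal_def, ht.le]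

theorem norm_inv_smul_tsum_le {a : ℕ → E} {t : ℝ} (ht : 0 < t) {b : ℝ → ℝ}
    (hb : IntegrableOn b (Set.Ioi 0)) (hab : ∀ x > 0, ‖a ⌊t * x⌋₊‖ ≤ b x) :
    ‖t⁻¹ • ∑' k, a k‖ ≤ ∫ x in Set.Ioi 0, b x := by
  have hab' : ∀ᵐ x ∂volume.restrict (Set.Ioi (0 : ℝ)), ‖a ⌊t * x⌋₊‖ ≤ b x :=
    ae_restrict_of_forall_mem measurableSet_Ioi hab
  rw [← integral_comp_natFloor_mul_Ioi ht
    (hb.mono' (stronglyMeasurable_comp_natFloor_mul a t).aestronglyMeasurable hab')]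
  exact norm_integral_le_of_norm_le hb hab'

theorem tendsto_inv_smul_tsum_of_dominated {a : ℕ → ℕ → E} {g : ℝ → E} {b : ℝ → ℝ}
    (hb : IntegrableOn b (Set.Ioi 0))
    (hab : ∀ n : ℕ, 0 < n → ∀ x > 0, ‖a n ⌊(n : ℝ) * x⌋₊‖ ≤ b x)
    (hlim : ∀ x > 0, Tendsto (fun n : ℕ => a n ⌊(n : ℝ) * x⌋₊) atTop (𝓝 (g x))) :
    Tendsto (fun n : ℕ => (n : ℝ)⁻¹ • ∑' k, a n k) atTop (𝓝 (∫ x in Set.Ioi 0, g x)) := by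
  have hsm (n : ℕ) : AEStronglyMeasurable (fun x : ℝ => a n ⌊(n : ℝ) * x⌋₊)
      (volume.restrict (Set.Ioi 0)) :=
    (stronglyMeasurable_comp_natFloor_mul (a n) n).aestronglyMeasurable
  have hab' (n : ℕ) (hn : 0 < n) :
      ∀ᵐ x ∂volume.restrict (Set.Ioi (0 : ℝ)), ‖a n ⌊(n : ℝ) * x⌋₊‖ ≤ b x :=
    ae_restrict_of_forall_mem measurableSet_Ioi (hab n hn)
  refine (tendsto_integral_filter_of_dominated_convergence b (Eventually.of_forall hsm)
    ((eventually_gt_atTop 0).mono hab') hb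
    (ae_restrict_of_forall_mem measurableSet_Ioi hlim)).congr' ?_
  filter_upwards [eventually_gt_atTop 0] with n hn
  exact integral_comp_natFloor_mul_Ioi (Nat.cast_pos.2 hn) (hb.mono' (hsm n) (hab' n hn))

end RiemannSum

theorem rpow_neg_mul_exp_le {δ y : ℝ} (hδ : 0 < δ) (hy : 0 < y) :
    y ^ (-δ) * Real.exp (-(2 * y)⁻¹) ≤ (2 * δ) ^ δ * Real.exp (1 / 2) * (1 + y) ^ (-δ) := by
  have hbase : 1 + y⁻¹ ≤ 2 * δ * Real.exp ((1 + y⁻¹) / (2 * δ)) := by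
    rw [← div_le_iff₀' (by positivity)]
    linarith [Real.add_one_le_exp ((1 + y⁻¹) / (2 * δ))]
  have hpow : (1 + y⁻¹) ^ δ ≤ (2 * δ) ^ δ * Real.exp (1 / 2 + (2 * y)⁻¹) := by
    calc (1 + y⁻¹) ^ δ ≤ (2 * δ * Real.exp ((1 + y⁻¹) / (2 * δ))) ^ δ := by gcongr
      _ = _ := by
        rw [Real.mul_rpow (by positivity) (by positivity), ← Real.exp_mul]
        congr 2
        field_simp
  have hsplit : (1 + y⁻¹) ^ δ = (1 + y) ^ δ * y ^ (-δ) := by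
    rw [Real.rpow_neg hy.le, ← Real.inv_rpow hy.le,
      ← Real.mul_rpow (by positivity) (by positivity)]
    congr 1
    field_simp
    ring
  rw [hsplit, Real.exp_add] at hpow
  rw [Real.rpow_neg (by positivity : 0 ≤ 1 + y), Real.exp_neg, ← div_eq_mul_inv,
    ← div_eq_mul_inv, div_le_div_iff₀ (by positivity) (by positivity)]
  linarith

theorem integrableOn_one_add_rpow_neg_Ioi {δ : ℝ} (hδ : 1 < δ) :
    IntegrableOn (fun x : ℝ => (1 + x) ^ (-δ)) (Set.Ioi 0) := by
  simpa only [add_comm] using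
    integrableOn_add_rpow_Ioi_of_lt (neg_lt_neg hδ) (by norm_num : -(1 : ℝ) < 0)

theorem integral_rpow_neg_mul_exp_neg_inv {δ : ℝ} (hδ : 1 < δ) :
    ∫ x in Set.Ioi (0 : ℝ), x ^ (-δ) * Real.exp (-x⁻¹) = Real.Gamma (δ - 1) := by
  rw [Real.Gamma_eq_integral (sub_pos.2 hδ),
    ← integral_comp_rpow_Ioi (fun y => Real.exp (-y) * y ^ (δ - 1 - 1))
      (neg_ne_zero.2 (one_ne_zero (α := ℝ)))]
  refine setIntegral_congr_fun measurableSet_Ioi fun x (hx : 0 < x) => ?_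
  have hexp : x ^ (-1 - 1 : ℝ) * (x ^ (-1 : ℝ)) ^ (δ - 1 - 1) = x ^ (-δ) := by
    rw [← Real.rpow_mul hx.le, ← Real.rpow_add hx]
    ring_nf
  simp only [abs_neg, abs_one, one_mul, smul_eq_mul]
  rw [mul_left_comm, hexp, Real.rpow_neg_one, mul_comm]

/-- The `k`-th summand of the Riemann sum `n⁻¹ ∑_k scaledSummand δ B z n k` of mesh `n⁻¹` that
represents `n^(δ-1) ∑_k (k+1)^(-δ) B_k z_k^n`. -/
def scaledSummand (δ : ℝ) (B z : ℕ → ℂ) (n k : ℕ) : ℂ :=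
  (((k : ℝ) + 1) / n) ^ (-δ) • (B k * z k ^ n)

section ScaledSummand

variable {δ : ℝ} {B z : ℕ → ℂ}

theorem inv_smul_tsum_scaledSummand {n : ℕ} (hn : 0 < n) :
    (n : ℝ)⁻¹ • ∑' k, scaledSummand δ B z n k =
      (n : ℝ) ^ (δ - 1) • ∑' k : ℕ, ((k : ℝ) + 1) ^ (-δ) • (B k * z k ^ n) := by
  have hn' : (0 : ℝ) < n := Nat.cast_pos.2 hn
  rw [← tsum_const_smul'', ← tsum_const_smul'']
  refine tsum_congr fun k => ?_
  rw [scaledSummand, smul_smul, smul_smul, Real.div_rpow (by positivity) hn'.le,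
    Real.rpow_neg hn'.le δ, div_inv_eq_mul, Real.rpow_sub_one hn'.ne']
  congr 1
  ring

theorem norm_scaledSummand_natFloor_le {K : ℝ} (hδ : 0 < δ) (hB : ∀ k, ‖B k‖ ≤ K)
    (hz : ∀ k : ℕ, ‖z k‖ ≤ ((k : ℝ) + 1) / (k + 2)) {n : ℕ} (hn : 0 < n) {x : ℝ} (hx : 0 < x) :
    ‖scaledSummand δ B z n ⌊(n : ℝ) * x⌋₊‖ ≤
      K * ((2 * δ) ^ δ * Real.exp (1 / 2) * (1 + x) ^ (-δ)) := by
  have hn' : (0 : ℝ) < n := Nat.cast_pos.2 hn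
  have hK : 0 ≤ K := (norm_nonneg _).trans (hB 0)
  unfold scaledSummand
  set k := ⌊(n : ℝ) * x⌋₊
  set y : ℝ := ((k : ℝ) + 1) / n with hy
  have hy0 : 0 < y := by positivity
  have hxy : x ≤ y := by
    rw [hy, le_div_iff₀ hn', mul_comm]
    exact (Nat.lt_floor_add_one _).le
  have hzk : ‖z k‖ ≤ Real.exp (-((k : ℝ) + 2)⁻¹) := by
    refine (hz k).trans (le_trans (le_of_eq ?_) (Real.add_one_le_exp _))
    field_simp
    ring
  have hrate : (2 * y)⁻¹ ≤ n * ((k : ℝ) + 2)⁻¹ := by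
    rw [hy, ← mul_div_assoc, inv_div, ← div_eq_mul_inv]
    gcongr
    linarith
  have hzn : ‖z k‖ ^ n ≤ Real.exp (-(2 * y)⁻¹) := by
    calc ‖z k‖ ^ n ≤ Real.exp (-((k : ℝ) + 2)⁻¹) ^ n := by gcongr
      _ = Real.exp (-(n * ((k : ℝ) + 2)⁻¹)) := by rw [← Real.exp_nat_mul, mul_neg]
      _ ≤ Real.exp (-(2 * y)⁻¹) := Real.exp_le_exp.2 (neg_le_neg hrate)
  rw [norm_smul, norm_mul, norm_pow, Real.norm_of_nonneg (by positivity)]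
  calc y ^ (-δ) * (‖B k‖ * ‖z k‖ ^ n)
      ≤ y ^ (-δ) * (K * Real.exp (-(2 * y)⁻¹)) := by gcongr; exact hB k
    _ = K * (y ^ (-δ) * Real.exp (-(2 * y)⁻¹)) := by ring
    _ ≤ K * ((2 * δ) ^ δ * Real.exp (1 / 2) * (1 + y) ^ (-δ)) :=
        mul_le_mul_of_nonneg_left (rpow_neg_mul_exp_le hδ hy0) hK
    _ ≤ K * ((2 * δ) ^ δ * Real.exp (1 / 2) * (1 + x) ^ (-δ)) := by
        gcongr K * (_ * ?_)
        exact Real.rpow_le_rpow_of_nonpos (by positivity) (by linarith) (by linarith)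

theorem tendsto_pow_natFloor_mul (hz : Tendsto (fun k : ℕ => (k : ℂ) * (1 - z k)) atTop (𝓝 1))
    {x : ℝ} (hx : 0 < x) :
    Tendsto (fun n : ℕ => z ⌊(n : ℝ) * x⌋₊ ^ n) atTop (𝓝 (Complex.exp (-(x⁻¹ : ℝ)))) := by
  have hfloor : Tendsto (fun n : ℕ => ⌊(n : ℝ) * x⌋₊) atTop atTop :=
    tendsto_nat_floor_atTop.comp (tendsto_natCast_atTop_atTop.atTop_mul_const hx)
  have hratio : Tendsto (fun n : ℕ => ((((⌊(n : ℝ) * x⌋₊ : ℝ) / n)⁻¹ : ℝ) : ℂ)) atTop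
      (𝓝 ((x⁻¹ : ℝ) : ℂ)) := by
    refine (Complex.continuous_ofReal.tendsto _).comp (Tendsto.inv₀ ?_ hx.ne')
    simpa only [Function.comp_def, mul_comm] using
      (tendsto_nat_floor_mul_div_atTop hx.le).comp (tendsto_natCast_atTop_atTop (R := ℝ))
  have hlog : Tendsto (fun n : ℕ => (n : ℂ) * (z ⌊(n : ℝ) * x⌋₊ - 1)) atTop
      (𝓝 (-((x⁻¹ : ℝ) : ℂ))) := by
    rw [← mul_one ((x⁻¹ : ℝ) : ℂ)]
    refine (hratio.mul (hz.comp hfloor)).neg.congr' ?_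
    filter_upwards [hfloor.eventually_ge_atTop 1] with n hn
    have hk : ((⌊(n : ℝ) * x⌋₊ : ℕ) : ℂ) ≠ 0 := Nat.cast_ne_zero.2 (by lia)
    simp only [Function.comp_apply]
    push_cast
    field_simp
    ring
  simpa only [add_sub_cancel] using Complex.tendsto_one_add_pow_exp_of_tendsto hlog

theorem tendsto_scaledSummand_natFloor {C : ℂ} (hB : Tendsto B atTop (𝓝 C))
    (hz : Tendsto (fun k : ℕ => (k : ℂ) * (1 - z k)) atTop (𝓝 1)) {x : ℝ} (hx : 0 < x) :
    Tendsto (fun n : ℕ => scaledSummand δ B z n ⌊(n : ℝ) * x⌋₊) atTop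
      (𝓝 (((x ^ (-δ) * Real.exp (-x⁻¹) : ℝ) : ℂ) * C)) := by
  have hfloor : Tendsto (fun n : ℕ => ⌊(n : ℝ) * x⌋₊) atTop atTop :=
    tendsto_nat_floor_atTop.comp (tendsto_natCast_atTop_atTop.atTop_mul_const hx)
  have hratio : Tendsto (fun n : ℕ => ((⌊(n : ℝ) * x⌋₊ : ℝ) + 1) / n) atTop (𝓝 x) := by
    have h := (tendsto_nat_floor_mul_div_atTop hx.le).comp
      (tendsto_natCast_atTop_atTop (R := ℝ))
    simpa only [Function.comp_def, mul_comm x, add_div, add_zero] using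
      h.add (tendsto_const_div_atTop_nhds_zero_nat (1 : ℝ))
  have hlim : ((x ^ (-δ) * Real.exp (-x⁻¹) : ℝ) : ℂ) * C =
      x ^ (-δ) • (C * Complex.exp (-(x⁻¹ : ℝ))) := by
    rw [Complex.real_smul]
    push_cast
    ring
  rw [hlim]
  exact (hratio.rpow_const (Or.inl hx.ne')).smul
    ((hB.comp hfloor).mul (tendsto_pow_natFloor_mul hz hx))

theorem exists_norm_rpow_smul_tsum_le (hδ : 1 < δ) (K : ℝ) :
    ∃ D : ℝ, ∀ B z : ℕ → ℂ, (∀ k, ‖B k‖ ≤ K) → (∀ k : ℕ, ‖z k‖ ≤ ((k : ℝ) + 1) / (k + 2)) →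
      ∀ n : ℕ, 0 < n →
        ‖(n : ℝ) ^ (δ - 1) • ∑' k : ℕ, ((k : ℝ) + 1) ^ (-δ) • (B k * z k ^ n)‖ ≤ D := by
  refine ⟨∫ x in Set.Ioi 0, K * ((2 * δ) ^ δ * Real.exp (1 / 2) * (1 + x) ^ (-δ)),
    fun B z hB hz n hn => ?_⟩
  rw [← inv_smul_tsum_scaledSummand hn]
  exact norm_inv_smul_tsum_le (Nat.cast_pos.2 hn)
    (((integrableOn_one_add_rpow_neg_Ioi hδ).const_mul _).const_mul K)
    fun x hx => norm_scaledSummand_natFloor_le (one_pos.trans hδ) hB hz hn hx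

theorem tendsto_rpow_smul_tsum {K : ℝ} {C : ℂ} (hδ : 1 < δ) (hBK : ∀ k, ‖B k‖ ≤ K)
    (hBC : Tendsto B atTop (𝓝 C)) (hz : ∀ k : ℕ, ‖z k‖ ≤ ((k : ℝ) + 1) / (k + 2))
    (hz1 : Tendsto (fun k : ℕ => (k : ℂ) * (1 - z k)) atTop (𝓝 1)) :
    Tendsto (fun n : ℕ => (n : ℝ) ^ (δ - 1) • ∑' k : ℕ, ((k : ℝ) + 1) ^ (-δ) • (B k * z k ^ n))
      atTop (𝓝 (Real.Gamma (δ - 1) * C)) := by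
  rw [← integral_rpow_neg_mul_exp_neg_inv hδ, ← integral_complex_ofReal, ← integral_mul_const]
  refine (tendsto_inv_smul_tsum_of_dominated
    (((integrableOn_one_add_rpow_neg_Ioi hδ).const_mul _).const_mul K)
    (fun n hn x hx => norm_scaledSummand_natFloor_le (one_pos.trans hδ) hBK hz hn hx)
    fun x hx => tendsto_scaledSummand_natFloor hBC hz1 hx).congr' ?_
  filter_upwards [eventually_gt_atTop 0] with n hn
  exact inv_smul_tsum_scaledSummand hn

end ScaledSummand

open Asymptotics Metric

theorem isBigO_mul_sub_one_add {ι : Type*} {l : Filter ι} {x a b : ι → ℂ} {α β : ℂ}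
    (hx : x =O[l] fun _ => (1 : ℂ)) (ha : (fun i => a i - (1 + α * x i)) =O[l] fun i => x i ^ 2)
    (hb : (fun i => b i - (1 + β * x i)) =O[l] fun i => x i ^ 2) :
    (fun i => a i * b i - (1 + (α + β) * x i)) =O[l] fun i => x i ^ 2 := by
  have hlin (γ : ℂ) : (fun i => 1 + γ * x i) =O[l] fun _ => (1 : ℂ) :=
    (isBigO_refl _ l).add (hx.const_mul_left γ)
  have hb1 : b =O[l] fun _ => (1 : ℂ) := by
    have hx2 : (fun i => x i ^ 2) =O[l] fun _ => (1 : ℂ) := by simpa using hx.pow 2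
    simpa using (hb.trans hx2).add (hlin β)
  have h := (((ha.mul hb1).congr_right fun _ => mul_one _).add
    (((hlin α).mul hb).congr_right fun _ => one_mul _)).add
    ((isBigO_refl (fun i => x i ^ 2) l).const_mul_left (α * β))
  exact h.congr_left fun i => by ring

/-- The probability generating function `z ↦ 1 / (2 - z)` of the geometric distribution with
parameter `1/2`. -/
def geomPGF (z : ℂ) : ℂ := (2 - z)⁻¹

theorem two_sub_ne_zero_of_norm_le_one {z : ℂ} (hz : ‖z‖ ≤ 1) : 2 - z ≠ 0 := by
  intro h
  rw [← sub_eq_zero.1 h] at hz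
  norm_num at hz

section Iterate

variable {s : ℂ}

theorem norm_iterate_geomPGF_le (hs : ‖s‖ ≤ 1 / 2) (k : ℕ) :
    ‖geomPGF^[k] s‖ ≤ ((k : ℝ) + 1) / (k + 2) := by
  induction k with
  | zero => simpa using hs
  | succ k ih =>
    have hden : ((k : ℝ) + 3) / (k + 2) ≤ ‖2 - geomPGF^[k] s‖ := by
      have htri : 2 - ‖geomPGF^[k] s‖ ≤ ‖2 - geomPGF^[k] s‖ := by
        simpa using norm_sub_norm_le (2 : ℂ) (geomPGF^[k] s)
      refine le_trans (le_of_eq ?_) ((sub_le_sub_left ih 2).trans htri)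
      field_simp
      ring
    rw [Function.iterate_succ_apply', geomPGF, norm_inv]
    calc ‖2 - geomPGF^[k] s‖⁻¹ ≤ (((k : ℝ) + 3) / (k + 2))⁻¹ := by gcongr
      _ = _ := by push_cast; field_simp; ring

theorem norm_iterate_geomPGF_le_one (hs : ‖s‖ ≤ 1 / 2) (k : ℕ) : ‖geomPGF^[k] s‖ ≤ 1 :=
  (norm_iterate_geomPGF_le hs k).trans (div_le_one_of_le₀ (by linarith) (by positivity))

theorem continuousOn_iterate_geomPGF (k : ℕ) :
    ContinuousOn geomPGF^[k] (closedBall 0 (1 / 2)) := by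
  induction k with
  | zero => exact continuousOn_id
  | succ k ih =>
    rw [Function.iterate_succ']
    exact (continuousOn_const.sub ih).inv₀ fun s hs => two_sub_ne_zero_of_norm_le_one
      (norm_iterate_geomPGF_le_one (mem_closedBall_zero_iff.1 hs) k)

theorem one_add_mul_one_sub_ne_zero (hs : s.re < 1) (k : ℕ) : 1 + (k : ℂ) * (1 - s) ≠ 0 := by
  intro h
  have hre : 1 + (k : ℝ) * (1 - s.re) = 0 := by simpa using congrArg Complex.re h
  nlinarith [(Nat.cast_nonneg k : (0 : ℝ) ≤ k)]

theorem one_sub_iterate_geomPGF (hs : s.re < 1) (k : ℕ) :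
    1 - geomPGF^[k] s = (1 - s) / (1 + k * (1 - s)) := by
  induction k with
  | zero => simp
  | succ k ih =>
    have hk := one_add_mul_one_sub_ne_zero hs k
    have hk1 := one_add_mul_one_sub_ne_zero hs (k + 1)
    have hsub : 2 - geomPGF^[k] s = (1 + (k + 1 : ℕ) * (1 - s)) / (1 + k * (1 - s)) := by
      rw [show 2 - geomPGF^[k] s = 1 + (1 - geomPGF^[k] s) by ring, ih, one_add_div hk]
      push_cast
      ring
    rw [Function.iterate_succ_apply', geomPGF, hsub, inv_div, one_sub_div hk1]
    push_cast
    ring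

theorem iterate_geomPGF_zero (k : ℕ) : geomPGF^[k] 0 = (((k : ℝ) / (k + 1) : ℝ) : ℂ) := by
  have hk : (1 : ℂ) + k ≠ 0 := by simpa using one_add_mul_one_sub_ne_zero (s := 0) (by simp) k
  rw [← sub_sub_cancel 1 (geomPGF^[k] 0), one_sub_iterate_geomPGF (by simp), sub_zero, mul_one,
    one_sub_div hk, add_sub_cancel_left, add_comm]
  push_cast
  rfl

theorem norm_one_sub_iterate_geomPGF_sub_le (hs : ‖s‖ ≤ 1 / 2) (k : ℕ) :
    ‖1 - geomPGF^[k] s - ((k : ℂ) + 1)⁻¹‖ ≤ ‖(((k : ℂ) + 1)⁻¹) ^ 2‖ := by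
  have hre : s.re ≤ 1 / 2 := (Complex.re_le_norm s).trans hs
  have hden : ((k : ℝ) + 1) / 2 ≤ ‖1 + (k : ℂ) * (1 - s)‖ := by
    refine le_trans ?_ (Complex.re_le_norm _)
    have hval : (1 + (k : ℂ) * (1 - s)).re = 1 + k * (1 - s.re) := by simp
    nlinarith [(Nat.cast_nonneg k : (0 : ℝ) ≤ k)]
  have hk : (k : ℂ) + 1 ≠ 0 := Nat.cast_add_one_ne_zero k
  have hnorm : ‖(k : ℂ) + 1‖ = k + 1 := by simpa using Complex.norm_natCast (k + 1)
  have hne := one_add_mul_one_sub_ne_zero (hre.trans_lt (by norm_num)) k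
  have heq : 1 - geomPGF^[k] s - ((k : ℂ) + 1)⁻¹ =
      -s / ((1 + (k : ℂ) * (1 - s)) * ((k : ℂ) + 1)) := by
    rw [one_sub_iterate_geomPGF (hre.trans_lt (by norm_num)), inv_eq_one_div,
      div_sub_div _ _ hne hk]
    ring
  rw [heq, norm_div, norm_neg, norm_mul, norm_pow, norm_inv, hnorm]
  calc ‖s‖ / (‖1 + (k : ℂ) * (1 - s)‖ * ((k : ℝ) + 1))
      ≤ (1 / 2) / (((k : ℝ) + 1) / 2 * ((k : ℝ) + 1)) := by gcongr
    _ = _ := by field_simp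

theorem tendsto_mul_one_sub_iterate_geomPGF (hs : s.re < 1) :
    Tendsto (fun k : ℕ => (k : ℂ) * (1 - geomPGF^[k] s)) atTop (𝓝 1) := by
  have hs1 : 1 - s ≠ 0 := sub_ne_zero.2 fun h => by simp [← h] at hs
  have hlim := (tendsto_inv_atTop_nhds_zero_nat (𝕜 := ℂ)).add_const (1 - s)
  have h := hlim.inv₀ (by simpa using hs1) |>.const_mul (1 - s)
  rw [zero_add, mul_inv_cancel₀ hs1] at h
  refine h.congr' ?_
  filter_upwards [eventually_gt_atTop 0] with k hk
  have hk0 : (k : ℂ) ≠ 0 := Nat.cast_ne_zero.2 hk.ne'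
  have hfactor : (k : ℂ)⁻¹ + (1 - s) = (1 + k * (1 - s)) / k := by
    field_simp
  rw [hfactor, one_sub_iterate_geomPGF hs, inv_div]
  ring

end Iterate

theorem abs_one_add_rpow_sub_le {δ y : ℝ} (hδ : 1 ≤ δ) (hy : 0 ≤ y) (hy1 : y ≤ 1) :
    |(1 + y) ^ δ - (1 + δ * y)| ≤ δ ^ 2 * Real.exp δ * y ^ 2 := by
  have hlower := one_add_mul_self_le_rpow_one_add (by linarith : -1 ≤ y) hδ
  have hupper : (1 + y) ^ δ ≤ Real.exp (δ * y) := by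
    calc (1 + y) ^ δ ≤ Real.exp y ^ δ := by gcongr; linarith [Real.add_one_le_exp y]
      _ = Real.exp (δ * y) := by rw [← Real.exp_mul, mul_comm]
  have hexp : Real.exp (δ * y) - (1 + δ * y) ≤ (δ * y) ^ 2 * Real.exp (δ * y) := by
    have h := Complex.norm_exp_sub_sum_le_norm_mul_exp ((δ * y : ℝ) : ℂ) 2
    rw [Complex.norm_real, Real.norm_of_nonneg (by positivity), ← Complex.ofReal_exp] at h
    have hre := (Complex.re_le_norm _).trans h
    rw [Complex.sub_re, Complex.ofReal_re] at hre
    simpa [Finset.sum_range_succ] using hre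
  have hmono : Real.exp (δ * y) ≤ Real.exp δ :=
    Real.exp_le_exp.2 (mul_le_of_le_one_right (by linarith) hy1)
  rw [abs_of_nonneg (sub_nonneg.2 hlower)]
  calc (1 + y) ^ δ - (1 + δ * y) ≤ (δ * y) ^ 2 * Real.exp (δ * y) := by linarith
    _ ≤ (δ * y) ^ 2 * Real.exp δ := by gcongr
    _ = δ ^ 2 * Real.exp δ * y ^ 2 := by ring

/-- The expansion `G z = 1 - δ (1 - z) + O(|1 - z|²)`, uniformly on the closed unit disc. -/
def HasDriftExpansion (G : ℂ → ℂ) (δ : ℝ) : Prop :=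
  (fun z => G z - (1 - δ * (1 - z))) =O[𝓟 (closedBall 0 1)] fun z => (1 - z) ^ 2

/-- The product `∏_{i < k} G (f_i s)` of the values of `G` along the orbit of `s` under the
geometric generating function, `f_i` being its `i`-th iterate. -/
def orbitProd (G : ℂ → ℂ) (k : ℕ) (s : ℂ) : ℂ := ∏ i ∈ Finset.range k, G (geomPGF^[i] s)

/-- The factors `G (f_i s) ((i + 2) / (i + 1))^δ` of `orbitProd G k s * (k + 1)^δ`. If `G` has
drift `δ` they are `1 + O(i⁻²)`, so that their product converges. -/
def normalizedFactor (G : ℂ → ℂ) (δ : ℝ) (s : ℂ) (i : ℕ) : ℂ :=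
  (((1 + ((i : ℝ) + 1)⁻¹) ^ δ : ℝ) : ℂ) * G (geomPGF^[i] s)

theorem orbitProd_eq_rpow_smul_prod (G : ℂ → ℂ) (δ : ℝ) (s : ℂ) (k : ℕ) :
    orbitProd G k s = ((k : ℝ) + 1) ^ (-δ) • ∏ i ∈ Finset.range k, normalizedFactor G δ s i := by
  induction k with
  | zero => simp [orbitProd]
  | succ k ih =>
    have hstep : ((k : ℝ) + 1) ^ (-δ) =
        ((k : ℝ) + 1 + 1) ^ (-δ) * (1 + ((k : ℝ) + 1)⁻¹) ^ δ := by
      rw [Real.rpow_neg (by positivity), Real.rpow_neg (by positivity),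
        ← Real.inv_rpow (by positivity), ← Real.inv_rpow (by positivity),
        ← Real.mul_rpow (by positivity) (by positivity)]
      congr 1
      field_simp
    rw [orbitProd, Finset.prod_range_succ, ← orbitProd, ih, Finset.prod_range_succ,
      normalizedFactor, Complex.real_smul, Complex.real_smul, hstep]
    push_cast
    ring

theorem norm_natCast_add_one_inv (k : ℕ) : ‖((k : ℂ) + 1)⁻¹‖ = ((k : ℝ) + 1)⁻¹ := by
  rw [norm_inv, ← Nat.cast_add_one, Complex.norm_natCast, Nat.cast_add_one]

theorem summable_norm_natCast_add_one_inv_sq :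
    Summable fun k : ℕ => ‖(((k : ℂ) + 1)⁻¹) ^ 2‖ := by
  simpa only [norm_pow, norm_natCast_add_one_inv, ← inv_pow, Nat.cast_add_one] using
    (summable_nat_add_iff 1).2 (Real.summable_nat_pow_inv.2 one_lt_two)

section NormalizedFactor

variable {G : ℂ → ℂ} {δ : ℝ}

theorem isBigO_normalizedFactor_sub_one (hδ : 1 ≤ δ) (hG : HasDriftExpansion G δ) :
    (fun p : ℂ × ℕ => normalizedFactor G δ p.1 p.2 - 1)
      =O[𝓟 (closedBall 0 (1 / 2) ×ˢ Set.univ)] fun p => (((p.2 : ℂ) + 1)⁻¹) ^ 2 := by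
  set l : Filter (ℂ × ℕ) := 𝓟 (closedBall 0 (1 / 2) ×ˢ Set.univ)
  set x : ℂ × ℕ → ℂ := fun p => ((p.2 : ℂ) + 1)⁻¹
  have hxnorm (p : ℂ × ℕ) : ‖x p‖ = ((p.2 : ℝ) + 1)⁻¹ := norm_natCast_add_one_inv p.2
  have hx1 (p : ℂ × ℕ) : ((p.2 : ℝ) + 1)⁻¹ ≤ 1 := inv_le_one_of_one_le₀ (by simp)
  have hx : x =O[l] fun _ => (1 : ℂ) :=
    IsBigO.of_bound 1 (Eventually.of_forall fun p => by simpa [hxnorm p] using hx1 p)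
  have hdist : (fun p : ℂ × ℕ => 1 - geomPGF^[p.2] p.1 - x p) =O[l] fun p => x p ^ 2 := by
    refine IsBigO.of_bound 1 (eventually_principal.2 fun p hp => ?_)
    rw [one_mul]
    exact norm_one_sub_iterate_geomPGF_sub_le (mem_closedBall_zero_iff.1 hp.1) p.2
  have hdist' : (fun p : ℂ × ℕ => 1 - geomPGF^[p.2] p.1) =O[l] x := by
    have hsq : (fun p => x p ^ 2) =O[l] x := by simpa [sq] using hx.mul (isBigO_refl x l)
    simpa using (hdist.trans hsq).add (isBigO_refl x l)
  have hunit : Tendsto (fun p : ℂ × ℕ => geomPGF^[p.2] p.1) l (𝓟 (closedBall 0 1)) :=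
    tendsto_principal_principal.2 fun p hp => mem_closedBall_zero_iff.2
      (norm_iterate_geomPGF_le_one (mem_closedBall_zero_iff.1 hp.1) p.2)
  have hGorbit : (fun p : ℂ × ℕ => G (geomPGF^[p.2] p.1) - (1 + -δ * x p))
      =O[l] fun p => x p ^ 2 := by
    refine (((hG.comp_tendsto hunit).trans (hdist'.pow 2)).sub
      (hdist.const_mul_left (δ : ℂ))).congr_left fun p => ?_
    simp only [Function.comp_apply]
    ring
  have hrpow : (fun p : ℂ × ℕ => (((1 + ((p.2 : ℝ) + 1)⁻¹) ^ δ : ℝ) : ℂ) - (1 + δ * x p))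
      =O[l] fun p => x p ^ 2 := by
    refine IsBigO.of_bound (δ ^ 2 * Real.exp δ) (Eventually.of_forall fun p => ?_)
    have h := abs_one_add_rpow_sub_le hδ (by positivity) (hx1 p)
    rw [norm_pow, hxnorm p]
    rw [← Real.norm_eq_abs, ← Complex.norm_real] at h
    simpa [x] using h
  refine (isBigO_mul_sub_one_add hx hrpow hGorbit).congr_left fun p => ?_
  rw [add_neg_cancel, zero_mul, add_zero, normalizedFactor]

theorem exists_norm_normalizedFactor_sub_one_le (hδ : 1 ≤ δ) (hG : HasDriftExpansion G δ) :
    ∃ K : ℝ, 0 ≤ K ∧ ∀ s : ℂ, ‖s‖ ≤ 1 / 2 → ∀ i : ℕ,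
      ‖normalizedFactor G δ s i - 1‖ ≤ K * ‖(((i : ℂ) + 1)⁻¹) ^ 2‖ := by
  obtain ⟨K, hK0, hK⟩ := (isBigO_normalizedFactor_sub_one hδ hG).exists_nonneg
  exact ⟨K, hK0, fun s hs i => isBigOWith_principal.1 hK (s, i)
    ⟨mem_closedBall_zero_iff.2 hs, Set.mem_univ i⟩⟩

theorem exists_norm_prod_normalizedFactor_le (hδ : 1 ≤ δ) (hG : HasDriftExpansion G δ) :
    ∃ K : ℝ, ∀ s : ℂ, ‖s‖ ≤ 1 / 2 → ∀ k : ℕ,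
      ‖∏ i ∈ Finset.range k, normalizedFactor G δ s i‖ ≤ K := by
  obtain ⟨K, hK0, hK⟩ := exists_norm_normalizedFactor_sub_one_le hδ hG
  refine ⟨Real.exp (∑' i : ℕ, K * ‖(((i : ℂ) + 1)⁻¹) ^ 2‖), fun s hs k => ?_⟩
  rw [norm_prod]
  calc ∏ i ∈ Finset.range k, ‖normalizedFactor G δ s i‖
      ≤ ∏ i ∈ Finset.range k, (1 + K * ‖(((i : ℂ) + 1)⁻¹) ^ 2‖) := by
        refine Finset.prod_le_prod (fun _ _ => norm_nonneg _) fun i _ => ?_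
        rw [← add_sub_cancel 1 (normalizedFactor G δ s i)]
        exact norm_add_le_of_le norm_one.le (hK s hs i)
    _ ≤ Real.exp (∑ i ∈ Finset.range k, K * ‖(((i : ℂ) + 1)⁻¹) ^ 2‖) :=
        Real.prod_one_add_le_exp_sum _ fun i => by positivity
    _ ≤ Real.exp (∑' i : ℕ, K * ‖(((i : ℂ) + 1)⁻¹) ^ 2‖) :=
        Real.exp_le_exp.2 ((summable_norm_natCast_add_one_inv_sq.mul_left K).sum_le_tsum _
          fun i _ => by positivity)

variable {s : ℂ}

theorem summable_norm_normalizedFactor_sub_one (hδ : 1 ≤ δ) (hG : HasDriftExpansion G δ)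
    (hs : ‖s‖ ≤ 1 / 2) : Summable fun i => ‖normalizedFactor G δ s i - 1‖ := by
  obtain ⟨K, -, hK⟩ := exists_norm_normalizedFactor_sub_one_le hδ hG
  exact (summable_norm_natCast_add_one_inv_sq.mul_left K).of_nonneg_of_le
    (fun _ => norm_nonneg _) (hK s hs)

theorem tendsto_prod_normalizedFactor (hδ : 1 ≤ δ) (hG : HasDriftExpansion G δ)
    (hs : ‖s‖ ≤ 1 / 2) :
    Tendsto (fun k => ∏ i ∈ Finset.range k, normalizedFactor G δ s i) atTop
      (𝓝 (∏' i, normalizedFactor G δ s i)) := by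
  have h := multipliable_one_add_of_summable (summable_norm_normalizedFactor_sub_one hδ hG hs)
  simp only [add_sub_cancel] at h
  exact h.hasProd.tendsto_prod_nat

theorem tprod_normalizedFactor_ne_zero (hδ : 1 ≤ δ) (hG : HasDriftExpansion G δ)
    (hs : ‖s‖ ≤ 1 / 2) (h0 : ∀ i, normalizedFactor G δ s i ≠ 0) :
    ∏' i, normalizedFactor G δ s i ≠ 0 := by
  simpa only [add_sub_cancel] using tprod_one_add_ne_zero_of_summable
    (f := fun i => normalizedFactor G δ s i - 1) (by simpa only [add_sub_cancel] using h0)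
    (summable_norm_normalizedFactor_sub_one hδ hG hs)

end NormalizedFactor

/-- The series `∑_k (∏_{i < k} G (f_i s)) (f_k s)^n` over the orbit of `s`. For a branching process
whose offspring sum of `v` individuals has generating function `G z * f(z)^v`, it is the generating
series `∑_k E_n[s^{V_k}]` of the Green function. -/
def greenSeries (G : ℂ → ℂ) (n : ℕ) (s : ℂ) : ℂ :=
  ∑' k, orbitProd G k s * geomPGF^[k] s ^ n

section GreenSeries

variable {G : ℂ → ℂ} {δ : ℝ}

theorem greenSeries_eq_tsum_rpow_smul (G : ℂ → ℂ) (δ : ℝ) (n : ℕ) (s : ℂ) :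
    greenSeries G n s = ∑' k : ℕ, ((k : ℝ) + 1) ^ (-δ) •
      ((∏ i ∈ Finset.range k, normalizedFactor G δ s i) * geomPGF^[k] s ^ n) :=
  tsum_congr fun k => by rw [orbitProd_eq_rpow_smul_prod G δ, smul_mul_assoc]

theorem exists_norm_rpow_smul_greenSeries_le (hδ : 1 < δ) (hG : HasDriftExpansion G δ) :
    ∃ D : ℝ, ∀ s : ℂ, ‖s‖ ≤ 1 / 2 → ∀ n : ℕ, 0 < n →
      ‖(n : ℝ) ^ (δ - 1) • greenSeries G n s‖ ≤ D := by
  obtain ⟨K, hK⟩ := exists_norm_prod_normalizedFactor_le hδ.le hG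
  obtain ⟨D, hD⟩ := exists_norm_rpow_smul_tsum_le hδ K
  refine ⟨D, fun s hs n hn => ?_⟩
  rw [greenSeries_eq_tsum_rpow_smul G δ]
  exact hD _ _ (hK s hs) (norm_iterate_geomPGF_le hs) n hn

theorem tendsto_rpow_smul_greenSeries (hδ : 1 < δ) (hG : HasDriftExpansion G δ) {s : ℂ}
    (hs : ‖s‖ ≤ 1 / 2) :
    Tendsto (fun n : ℕ => (n : ℝ) ^ (δ - 1) • greenSeries G n s) atTop
      (𝓝 (Real.Gamma (δ - 1) * ∏' i, normalizedFactor G δ s i)) := by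
  obtain ⟨K, hK⟩ := exists_norm_prod_normalizedFactor_le hδ.le hG
  have hre : s.re < 1 := (Complex.re_le_norm s).trans_lt (hs.trans_lt (by norm_num))
  simp_rw [greenSeries_eq_tsum_rpow_smul G δ]
  exact tendsto_rpow_smul_tsum hδ (hK s hs) (tendsto_prod_normalizedFactor hδ.le hG hs)
    (norm_iterate_geomPGF_le hs) (tendsto_mul_one_sub_iterate_geomPGF hre)

theorem exists_summable_norm_orbitProd_mul_pow_le (hδ : 1 < δ) (hG : HasDriftExpansion G δ) :
    ∃ b : ℕ → ℝ, Summable b ∧ ∀ s : ℂ, ‖s‖ ≤ 1 / 2 → ∀ n k,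
      ‖orbitProd G k s * geomPGF^[k] s ^ n‖ ≤ b k := by
  obtain ⟨K, hK⟩ := exists_norm_prod_normalizedFactor_le hδ.le hG
  have hsum := (summable_nat_add_iff 1).2 (Real.summable_nat_rpow.2 (neg_lt_neg hδ))
  refine ⟨_, hsum.mul_right K, fun s hs n k => ?_⟩
  have hpow : ‖geomPGF^[k] s ^ n‖ ≤ 1 := by
    rw [norm_pow]
    exact pow_le_one₀ (norm_nonneg _) (norm_iterate_geomPGF_le_one hs k)
  rw [norm_mul, orbitProd_eq_rpow_smul_prod G δ, norm_smul, Real.norm_of_nonneg (by positivity),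
    Nat.cast_add_one]
  exact (mul_le_of_le_one_right (by positivity) hpow).trans (by gcongr; exact hK s hs k)

theorem exists_norm_greenSeries_le (hδ : 1 < δ) (hG : HasDriftExpansion G δ) :
    ∃ D : ℝ, ∀ s : ℂ, ‖s‖ ≤ 1 / 2 → ∀ n : ℕ, ‖greenSeries G n s‖ ≤ D := by
  obtain ⟨b, hbs, hb⟩ := exists_summable_norm_orbitProd_mul_pow_le hδ hG
  exact ⟨∑' k, b k, fun s hs n => tsum_of_norm_bounded hbs.hasSum (hb s hs n)⟩

theorem continuousOn_greenSeries (hδ : 1 < δ) (hG : HasDriftExpansion G δ)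
    (hGc : ContinuousOn G (closedBall 0 1)) (n : ℕ) :
    ContinuousOn (greenSeries G n) (closedBall 0 (1 / 2)) := by
  obtain ⟨b, hbs, hb⟩ := exists_summable_norm_orbitProd_mul_pow_le hδ hG
  refine continuousOn_tsum (fun k => ?_) hbs fun k s hs => hb s (mem_closedBall_zero_iff.1 hs) n k
  refine ContinuousOn.mul (continuousOn_finsetProd _ fun i _ => ?_)
    ((continuousOn_iterate_geomPGF k).pow n)
  exact hGc.comp (continuousOn_iterate_geomPGF i) fun s hs => mem_closedBall_zero_iff.2
    (norm_iterate_geomPGF_le_one (mem_closedBall_zero_iff.1 hs) i)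

open scoped ComplexOrder in
theorem tprod_normalizedFactor_zero_pos (hδ : 1 ≤ δ) (hG : HasDriftExpansion G δ)
    (hpos : ∀ r : ℝ, 0 ≤ r → r < 1 → 0 < G r) : 0 < ∏' i, normalizedFactor G δ 0 i := by
  have hfactor (i : ℕ) : 0 < normalizedFactor G δ 0 i := by
    have hweight : 0 < (1 + ((i : ℝ) + 1)⁻¹) ^ δ := by positivity
    rw [normalizedFactor, iterate_geomPGF_zero]
    exact mul_pos (Complex.zero_lt_real.2 hweight)
      (hpos _ (by positivity) ((div_lt_one (by positivity)).2 (by linarith)))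
  have hs : ‖(0 : ℂ)‖ ≤ 1 / 2 := by simp
  exact lt_of_le_of_ne
    (ge_of_tendsto' (tendsto_prod_normalizedFactor hδ hG hs)
      fun k => (Finset.prod_pos fun i _ => hfactor i).le)
    (tprod_normalizedFactor_ne_zero hδ hG hs fun i => (hfactor i).ne').symm

open scoped ComplexOrder in
theorem exists_pos_tendsto_rpow_mul_re_greenSeries_zero (hδ : 1 < δ) (hG : HasDriftExpansion G δ)
    (hpos : ∀ r : ℝ, 0 ≤ r → r < 1 → 0 < G r) :
    ∃ c : ℝ, 0 < c ∧
      Tendsto (fun n : ℕ => (n : ℝ) ^ (δ - 1) * (greenSeries G n 0).re) atTop (𝓝 c) := by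
  have hlim := (Complex.continuous_re.tendsto _).comp
    (tendsto_rpow_smul_greenSeries hδ hG (s := 0) (by simp))
  simp only [Function.comp_def, Complex.smul_re, smul_eq_mul, Complex.re_ofReal_mul] at hlim
  exact ⟨_, mul_pos (Real.Gamma_pos_of_pos (sub_pos.2 hδ))
    (Complex.pos_iff.1 (tprod_normalizedFactor_zero_pos hδ.le hG hpos)).1, hlim⟩

end GreenSeries

section CircleAverage

variable {E : Type*} [NormedAddCommGroup E] [NormedSpace ℝ E] {c : ℂ} {R D : ℝ}

theorem tendsto_circleAverage {ι : Type*} {l : Filter ι} [l.IsCountablyGenerated]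
    {F : ι → ℂ → E} {f : ℂ → E} (hF : ∀ i, ContinuousOn (F i) (sphere c |R|))
    (hD : ∀ᶠ i in l, ∀ z ∈ sphere c |R|, ‖F i z‖ ≤ D)
    (hlim : ∀ z ∈ sphere c |R|, Tendsto (fun i => F i z) l (𝓝 (f z))) :
    Tendsto (fun i => Real.circleAverage (F i) c R) l (𝓝 (Real.circleAverage f c R)) := by
  simp only [Real.circleAverage_def]
  refine Tendsto.const_smul (intervalIntegral.tendsto_integral_filter_of_dominated_convergence
    (fun _ => D) (.of_forall fun i => ?_) ?_ intervalIntegrable_const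
    (.of_forall fun θ _ => hlim _ (circleMap_mem_sphere' c R θ))) _
  · exact ((hF i).comp_continuous (continuous_circleMap c R)
      (circleMap_mem_sphere' c R)).aestronglyMeasurable
  · filter_upwards [hD] with i hi
    exact .of_forall fun θ _ => hi _ (circleMap_mem_sphere' c R θ)

theorem hasSum_circleAverage {ι : Type*} [Countable ι] {F : ι → ℂ → E} {f : ℂ → E} {b : ι → ℝ}
    (hF : ∀ i, ContinuousOn (F i) (sphere c |R|)) (hb : Summable b)
    (hle : ∀ i, ∀ z ∈ sphere c |R|, ‖F i z‖ ≤ b i)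
    (hsum : ∀ z ∈ sphere c |R|, HasSum (fun i => F i z) (f z)) :
    HasSum (fun i => Real.circleAverage (F i) c R) (Real.circleAverage f c R) := by
  have hb0 (i : ι) : 0 ≤ b i :=
    (norm_nonneg _).trans (hle i _ (circleMap_mem_sphere' c R 0))
  have hpartial := tendsto_circleAverage (l := atTop) (D := ∑' i, b i)
    (F := fun (I : Finset ι) z => ∑ i ∈ I, F i z)
    (fun I => continuousOn_finsetSum _ fun i _ => hF i)
    (.of_forall fun I z hz => (norm_sum_le_of_le _ fun i _ => hle i z hz).trans
      (hb.sum_le_tsum _ fun i _ => hb0 i)) hsum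
  exact hpartial.congr fun I =>
    Real.circleAverage_fun_sum fun i _ => (hF i).circleIntegrable'

end CircleAverage

/-- The `j`-th Taylor coefficient of `F` at `0`, given by Cauchy's formula on the circle of
radius `r`. -/
def taylorCoeff (r : ℝ) (j : ℕ) (F : ℂ → ℂ) : ℂ :=
  Real.circleAverage (fun s => (s ^ j)⁻¹ * F s) 0 r

section TaylorCoeff

variable {r D : ℝ} {F : ℂ → ℂ}

theorem continuousOn_inv_pow_sphere (hr : r ≠ 0) (j : ℕ) :
    ContinuousOn (fun s : ℂ => (s ^ j)⁻¹) (sphere 0 |r|) :=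
  (continuous_pow j).continuousOn.inv₀ fun _ hs =>
    pow_ne_zero _ (ne_of_mem_sphere hs (abs_ne_zero.2 hr))

theorem norm_inv_pow_mul_le {j : ℕ} {s : ℂ} (hs : s ∈ sphere 0 |r|) (hF : ‖F s‖ ≤ D) :
    ‖(s ^ j)⁻¹ * F s‖ ≤ (|r| ^ j)⁻¹ * D := by
  rw [norm_mul, norm_inv, norm_pow, mem_sphere_zero_iff_norm.1 hs]
  gcongr

theorem taylorCoeff_pow (hr : r ≠ 0) (j v : ℕ) :
    taylorCoeff r j (fun s => s ^ v) = if v = j then 1 else 0 := by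
  have hzpow : (∮ s in C(0, r), (s - 0)⁻¹ • ((s ^ j)⁻¹ * s ^ v)) =
      ∮ s in C(0, r), (s - 0) ^ ((v : ℤ) - j - 1) := by
    refine intervalIntegral.integral_congr fun θ _ => congrArg _ ?_
    have hs0 : circleMap 0 r θ ≠ 0 := circleMap_ne_center hr
    simp only [sub_zero, zpow_sub₀ hs0, zpow_one, zpow_natCast, smul_eq_mul]
    field_simp
  rw [taylorCoeff, Real.circleAverage_eq_circleIntegral hr, hzpow]
  split_ifs with h
  · simp only [h, sub_self, zero_sub, zpow_neg_one]
    rw [circleIntegral.integral_sub_center_inv 0 hr, smul_eq_mul,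
      inv_mul_cancel₀ Complex.two_pi_I_ne_zero]
  · rw [circleIntegral.integral_sub_zpow_of_ne (by omega), smul_zero]

theorem taylorCoeff_const_mul (r : ℝ) (j : ℕ) (a : ℂ) (F : ℂ → ℂ) :
    taylorCoeff r j (fun s => a * F s) = a * taylorCoeff r j F := by
  simp only [taylorCoeff, mul_left_comm _ a]
  exact Real.circleAverage_fun_smul (a := a)

theorem taylorCoeff_sub {F' : ℂ → ℂ} (hr : r ≠ 0) (j : ℕ) (hF : ContinuousOn F (sphere 0 |r|))
    (hF' : ContinuousOn F' (sphere 0 |r|)) :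
    taylorCoeff r j (fun s => F s - F' s) = taylorCoeff r j F - taylorCoeff r j F' := by
  simp only [taylorCoeff, mul_sub]
  exact Real.circleAverage_fun_sub ((continuousOn_inv_pow_sphere hr j).mul hF).circleIntegrable'
    ((continuousOn_inv_pow_sphere hr j).mul hF').circleIntegrable'

theorem tendsto_taylorCoeff {ι : Type*} {l : Filter ι} [l.IsCountablyGenerated] {Φ : ι → ℂ → ℂ}
    (hr : r ≠ 0) (j : ℕ) (hΦ : ∀ i, ContinuousOn (Φ i) (sphere 0 |r|))
    (hD : ∀ᶠ i in l, ∀ s ∈ sphere 0 |r|, ‖Φ i s‖ ≤ D)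
    (hlim : ∀ s ∈ sphere 0 |r|, Tendsto (fun i => Φ i s) l (𝓝 (F s))) :
    Tendsto (fun i => taylorCoeff r j (Φ i)) l (𝓝 (taylorCoeff r j F)) :=
  tendsto_circleAverage (fun i => (continuousOn_inv_pow_sphere hr j).mul (hΦ i))
    (hD.mono fun _ hi s hs => norm_inv_pow_mul_le hs (hi s hs))
    fun s hs => (hlim s hs).const_mul _

theorem hasSum_taylorCoeff {ι : Type*} [Countable ι] {Φ : ι → ℂ → ℂ} {b : ι → ℝ} (hr : r ≠ 0)
    (j : ℕ) (hΦ : ∀ i, ContinuousOn (Φ i) (sphere 0 |r|)) (hb : Summable b)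
    (hle : ∀ i, ∀ s ∈ sphere 0 |r|, ‖Φ i s‖ ≤ b i)
    (hsum : ∀ s ∈ sphere 0 |r|, HasSum (fun i => Φ i s) (F s)) :
    HasSum (fun i => taylorCoeff r j (Φ i)) (taylorCoeff r j F) :=
  hasSum_circleAverage (fun i => (continuousOn_inv_pow_sphere hr j).mul (hΦ i)) (hb.mul_left _)
    (fun i s hs => norm_inv_pow_mul_le hs (hle i s hs)) fun s hs => (hsum s hs).mul_left _

end TaylorCoeff

/-- The generating function `∑_w b_w z^w` of a summable sequence of weights. For `b w = ν.real {w}`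
it is the probability generating function of `ν`; weights of both signs are needed below the level
from which the offspring sums have generating functions `G z * f(z)^v`. -/
def genFun (b : ℕ → ℝ) (z : ℂ) : ℂ := ∑' w, (b w : ℂ) * z ^ w

section GenFun

variable {b : ℕ → ℝ} {z : ℂ}

theorem norm_pow_le_one_of_norm_le_one (hz : ‖z‖ ≤ 1) (w : ℕ) : ‖z ^ w‖ ≤ 1 := by
  rw [norm_pow]
  exact pow_le_one₀ (norm_nonneg _) hz

theorem norm_ofReal_mul_pow_le (hz : ‖z‖ ≤ 1) (w : ℕ) : ‖(b w : ℂ) * z ^ w‖ ≤ ‖b w‖ := by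
  rw [norm_mul, Complex.norm_real]
  exact mul_le_of_le_one_right (norm_nonneg _) (norm_pow_le_one_of_norm_le_one hz w)

theorem hasSum_genFun (hb : Summable b) (hz : ‖z‖ ≤ 1) :
    HasSum (fun w => (b w : ℂ) * z ^ w) (genFun b z) :=
  (hb.norm.of_norm_bounded (norm_ofReal_mul_pow_le hz)).hasSum

theorem continuousOn_genFun (hb : Summable b) : ContinuousOn (genFun b) (closedBall 0 1) :=
  continuousOn_tsum (fun w => (continuous_const.mul (continuous_pow w)).continuousOn) hb.norm
    fun w _ hz => norm_ofReal_mul_pow_le (mem_closedBall_zero_iff.1 hz) w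

theorem exists_genFun_eq_mul_two_sub (hb : Summable b) :
    ∃ b' : ℕ → ℝ, Summable b' ∧ ∀ z, ‖z‖ ≤ 1 → genFun b' z = genFun b z * (2 - z) := by
  let shift : ℕ → ℝ := fun w => Nat.casesOn w 0 b
  have hshift : Summable shift := (summable_nat_add_iff 1).1 hb
  refine ⟨fun w => 2 * b w - shift w, (hb.mul_left 2).sub hshift, fun z hz => ?_⟩
  have hmul : genFun shift z = genFun b z * z := by
    rw [genFun, (hasSum_genFun hshift hz).summable.tsum_eq_zero_add, genFun, ← tsum_mul_right]
    simp [shift, pow_succ, mul_assoc]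
  have hdiff := ((hasSum_genFun hb hz).mul_left 2).sub (hasSum_genFun hshift hz)
  rw [mul_sub, ← hmul, mul_comm _ (2 : ℂ), ← hdiff.tsum_eq, genFun]
  exact tsum_congr fun w => by push_cast; ring

theorem exists_genFun_eq_mul_two_sub_pow (hb : Summable b) (m : ℕ) :
    ∃ b' : ℕ → ℝ, Summable b' ∧ ∀ z, ‖z‖ ≤ 1 → genFun b' z = genFun b z * (2 - z) ^ m := by
  induction m with
  | zero => exact ⟨b, hb, fun z _ => by simp⟩
  | succ m ih =>
    obtain ⟨b₁, hb₁, hgf₁⟩ := ih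
    obtain ⟨b₂, hb₂, hgf₂⟩ := exists_genFun_eq_mul_two_sub hb₁
    exact ⟨b₂, hb₂, fun z hz => by rw [hgf₂ z hz, hgf₁ z hz, pow_succ, mul_assoc]⟩

end GenFun

/-- The `j`-th Taylor coefficient of the generating series `s ↦ greenSeries G n s`, that is, the
Green function `∑_k P_n[V_k = j]`. The coefficients are real; taking the real part spares proving
it. -/
def greenCoeff (G : ℂ → ℂ) (j n : ℕ) : ℝ := (taylorCoeff (1 / 2) j (greenSeries G n)).re

section Green

variable {G : ℂ → ℂ} {δ : ℝ} {b : ℕ → ℝ} {v : ℕ}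

theorem hasSum_mul_greenSeries (hδ : 1 < δ) (hG : HasDriftExpansion G δ) (hb : Summable b)
    (hgf : ∀ z, ‖z‖ ≤ 1 → genFun b z = G z * geomPGF z ^ v) {s : ℂ} (hs : ‖s‖ ≤ 1 / 2) :
    HasSum (fun w => (b w : ℂ) * greenSeries G w s) (greenSeries G v s - s ^ v) := by
  obtain ⟨β, hβ, hle⟩ := exists_summable_norm_orbitProd_mul_pow_le hδ hG
  let F : ℕ × ℕ → ℂ := fun p => b p.2 * (orbitProd G p.1 s * geomPGF^[p.1] s ^ p.2)
  have hβ0 (k : ℕ) : 0 ≤ β k := (norm_nonneg _).trans (hle s hs 0 k)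
  have hF : Summable F := by
    refine (hβ.mul_of_nonneg hb.norm hβ0 fun w => norm_nonneg _).of_norm_bounded fun p => ?_
    rw [norm_mul, Complex.norm_real, mul_comm]
    gcongr
    exact hle s hs p.2 p.1
  have hfst (k : ℕ) : HasSum (fun w => F (k, w))
      (orbitProd G (k + 1) s * geomPGF^[k + 1] s ^ v) := by
    have hk := norm_iterate_geomPGF_le_one hs k
    have h := (hasSum_genFun hb hk).mul_left (orbitProd G k s)
    rw [hgf _ hk] at h
    rw [orbitProd, Finset.prod_range_succ, Function.iterate_succ_apply', mul_assoc]
    exact h.congr_fun fun w => mul_left_comm _ _ _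
  have hsnd (w : ℕ) : HasSum (fun k => F (k, w)) ((b w : ℂ) * greenSeries G w s) :=
    (hβ.of_norm_bounded (hle s hs w)).hasSum.mul_left _
  have htail := (hasSum_nat_add_iff' 1).2 (hβ.of_norm_bounded (hle s hs v)).hasSum
  have htotal : ∑' p, F p = greenSeries G v s - s ^ v := by
    rw [(hF.hasSum.prod_fiberwise hfst).unique htail]
    simp [greenSeries, orbitProd]
  rw [← htotal]
  exact ((Equiv.prodComm ℕ ℕ).hasSum_iff.2 hF.hasSum).prod_fiberwise hsnd

theorem continuousOn_greenSeries_sphere (hδ : 1 < δ) (hG : HasDriftExpansion G δ)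
    (hGc : ContinuousOn G (closedBall 0 1)) (n : ℕ) :
    ContinuousOn (greenSeries G n) (sphere 0 |1 / 2|) :=
  (continuousOn_greenSeries hδ hG hGc n).mono
    (by rw [abs_of_pos one_half_pos]; exact sphere_subset_closedBall)

theorem norm_le_of_mem_sphere_half {s : ℂ} (hs : s ∈ sphere (0 : ℂ) |1 / 2|) : ‖s‖ ≤ 1 / 2 := by
  rw [mem_sphere_zero_iff_norm.1 hs, abs_of_pos one_half_pos]

theorem hasSum_mul_greenCoeff (hδ : 1 < δ) (hG : HasDriftExpansion G δ)
    (hGc : ContinuousOn G (closedBall 0 1)) (hb : Summable b)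
    (hgf : ∀ z, ‖z‖ ≤ 1 → genFun b z = G z * geomPGF z ^ v) (j : ℕ) :
    HasSum (fun w => b w * greenCoeff G j w) (greenCoeff G j v - if v = j then 1 else 0) := by
  obtain ⟨D, hD⟩ := exists_norm_greenSeries_le hδ hG
  have hcont := continuousOn_greenSeries_sphere hδ hG hGc
  have h := hasSum_taylorCoeff (r := 1 / 2) (Φ := fun w s => (b w : ℂ) * greenSeries G w s)
    one_half_pos.ne' j
    (fun w => continuousOn_const.mul (hcont w)) (hb.norm.mul_right D)
    (fun w s hs => by
      rw [norm_mul, Complex.norm_real]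
      gcongr
      exact hD s (norm_le_of_mem_sphere_half hs) w)
    fun s hs => hasSum_mul_greenSeries hδ hG hb hgf (norm_le_of_mem_sphere_half hs)
  simp only [taylorCoeff_const_mul] at h
  rw [taylorCoeff_sub one_half_pos.ne' j (hcont v) (continuous_pow v).continuousOn,
    taylorCoeff_pow one_half_pos.ne'] at h
  convert Complex.hasSum_re h using 1
  · simp only [Complex.re_ofReal_mul, greenCoeff]
  · rw [greenCoeff, Complex.sub_re]
    split_ifs <;> rfl

theorem exists_tendsto_rpow_mul_greenCoeff (hδ : 1 < δ) (hG : HasDriftExpansion G δ)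
    (hGc : ContinuousOn G (closedBall 0 1)) (j : ℕ) :
    ∃ L : ℝ, Tendsto (fun n : ℕ => (n : ℝ) ^ (δ - 1) * greenCoeff G j n) atTop (𝓝 L) := by
  obtain ⟨D, hD⟩ := exists_norm_rpow_smul_greenSeries_le hδ hG
  have h := tendsto_taylorCoeff (r := 1 / 2)
    (Φ := fun (n : ℕ) s => (n : ℝ) ^ (δ - 1) • greenSeries G n s) one_half_pos.ne' j
    (fun n => (continuousOn_greenSeries_sphere hδ hG hGc n).const_smul ((n : ℝ) ^ (δ - 1)))
    ((eventually_gt_atTop 0).mono fun n hn s hs => hD s (norm_le_of_mem_sphere_half hs) n hn)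
    fun s hs => tendsto_rpow_smul_greenSeries hδ hG (norm_le_of_mem_sphere_half hs)
  refine ⟨_, ((Complex.continuous_re.tendsto _).comp h).congr fun n => ?_⟩
  simp only [Function.comp_apply, Complex.real_smul, taylorCoeff_const_mul, greenCoeff,
    Complex.re_ofReal_mul]

end Green

section DriftExpansion

variable {G H : ℂ → ℂ} {γ δ : ℝ}

theorem HasDriftExpansion.mul (hG : HasDriftExpansion G γ) (hH : HasDriftExpansion H δ) :
    HasDriftExpansion (fun z => G z * H z) (γ + δ) := by
  have hbdd : (fun z : ℂ => 1 - z) =O[𝓟 (closedBall 0 1)] fun _ => (1 : ℂ) :=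
    isBigO_principal.2 ⟨2, fun z hz => by
      have hz1 := mem_closedBall_zero_iff.1 hz
      rw [norm_one]
      linarith [norm_sub_le 1 z, norm_one (α := ℂ)]⟩
  have h := isBigO_mul_sub_one_add (α := -γ) (β := -δ) hbdd
    (hG.congr_left fun z => by ring) (hH.congr_left fun z => by ring)
  exact h.congr_left fun z => by push_cast; ring

theorem HasDriftExpansion.mul_two_sub_pow (hG : HasDriftExpansion G δ) (m : ℕ) :
    HasDriftExpansion (fun z => G z * (2 - z) ^ m) (δ - m) := by
  have htwo : HasDriftExpansion (fun z => 2 - z) (-1) :=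
    (isBigO_zero _ _).congr_left fun z => by push_cast; ring
  induction m with
  | zero => simpa using hG
  | succ m ih =>
    convert ih.mul htwo using 1
    · simp only [pow_succ, mul_assoc]
    · push_cast
      ring

theorem norm_pow_sub_one_sub_mul_le {z : ℂ} (hz : ‖z‖ ≤ 1) (w : ℕ) :
    ‖z ^ w - (1 - w * (1 - z))‖ ≤ (w : ℝ) ^ 2 * ‖(1 - z) ^ 2‖ := by
  induction w with
  | zero => simp
  | succ w ih =>
    have hrec : z ^ (w + 1) - (1 - ((w + 1 : ℕ) : ℂ) * (1 - z)) =
        z * (z ^ w - (1 - w * (1 - z))) + w * (1 - z) ^ 2 := by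
      push_cast
      ring
    calc ‖z ^ (w + 1) - (1 - ((w + 1 : ℕ) : ℂ) * (1 - z))‖
        ≤ 1 * ((w : ℝ) ^ 2 * ‖(1 - z) ^ 2‖) + w * ‖(1 - z) ^ 2‖ := by
          rw [hrec]
          refine (norm_add_le _ _).trans ?_
          rw [norm_mul, norm_mul, Complex.norm_natCast]
          gcongr
      _ ≤ ((w + 1 : ℕ) : ℝ) ^ 2 * ‖(1 - z) ^ 2‖ := by
          rw [one_mul, ← add_mul]
          gcongr
          push_cast
          nlinarith [(Nat.cast_nonneg w : (0 : ℝ) ≤ w)]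

theorem hasDriftExpansion_genFun {b : ℕ → ℝ} {m : ℝ} (hb : HasSum b 1)
    (hmean : HasSum (fun w => b w * w) m) (hsq : Summable fun w => b w * (w : ℝ) ^ 2) :
    HasDriftExpansion (genFun b) m := by
  refine isBigO_principal.2 ⟨∑' w, ‖b w * (w : ℝ) ^ 2‖, fun z hz => ?_⟩
  have hz1 := mem_closedBall_zero_iff.1 hz
  have hlin := (Complex.hasSum_ofReal.2 hb).sub
    ((Complex.hasSum_ofReal.2 hmean).mul_right (1 - z))
  have hdiff := (hasSum_genFun hb.summable hz1).sub hlin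
  rw [Complex.ofReal_one] at hdiff
  rw [← hdiff.tsum_eq]
  refine tsum_of_norm_bounded (hsq.norm.hasSum.mul_right _) fun w => ?_
  have hterm : (b w : ℂ) * z ^ w - (b w - ((b w * w : ℝ) : ℂ) * (1 - z)) =
      b w * (z ^ w - (1 - w * (1 - z))) := by
    push_cast
    ring
  rw [hterm, norm_mul, norm_mul, Complex.norm_real, mul_assoc, norm_pow, Real.norm_natCast]
  gcongr
  exact norm_pow_sub_one_sub_mul_le hz1 w

end DriftExpansion

section IntegralNat

variable {E : Type*} [NormedAddCommGroup E] (ν : Measure ℕ) {f : ℕ → E}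

theorem integrable_of_forall_norm_le [IsFiniteMeasure ν] {D : ℝ} (hf : ∀ n, ‖f n‖ ≤ D) :
    Integrable f ν :=
  .of_bound StronglyMeasurable.of_discrete.aestronglyMeasurable D (ae_of_all _ hf)

theorem integrable_of_tendsto_atTop [IsFiniteMeasure ν] {a : E} (hf : Tendsto f atTop (𝓝 a)) :
    Integrable f ν := by
  obtain ⟨D, hD⟩ := hf.norm.bddAbove_range
  exact integrable_of_forall_norm_le ν fun n => hD ⟨n, rfl⟩

theorem hasSum_measureReal_singleton_smul [NormedSpace ℝ E] [CompleteSpace E]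
    (hf : Integrable f ν) : HasSum (fun w => ν.real {w} • f w) (∫ w, f w ∂ν) := by
  have hdirac : Integrable f (Measure.sum fun w => ν {w} • Measure.dirac w) := by
    rwa [Measure.sum_smul_dirac]
  have h := hasSum_integral_measure hdirac
  simpa [Measure.sum_smul_dirac, measureReal_def] using h

end IntegralNat

/-- The probability generating function of a law on `ℕ`. -/
def pgf (ν : Measure ℕ) : ℂ → ℂ := genFun fun w => ν.real {w}

section PGF

variable (ν : Measure ℕ)

theorem hasSum_measureReal_singleton [IsProbabilityMeasure ν] : HasSum (fun w => ν.real {w}) 1 := by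
  simpa using hasSum_measureReal_singleton_smul ν (integrable_const (1 : ℝ))

theorem integral_pow_eq_pgf [IsFiniteMeasure ν] {z : ℂ} (hz : ‖z‖ ≤ 1) :
    ∫ w, z ^ w ∂ν = pgf ν z := by
  have h := hasSum_measureReal_singleton_smul ν
    (integrable_of_forall_norm_le ν (norm_pow_le_one_of_norm_le_one hz))
  simpa only [pgf, genFun, Complex.real_smul] using h.tsum_eq.symm

theorem hasDriftExpansion_pgf [IsProbabilityMeasure ν] (h : MemLp (fun w : ℕ => (w : ℝ)) 2 ν) :
    HasDriftExpansion (pgf ν) (∫ w, (w : ℝ) ∂ν) :=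
  hasDriftExpansion_genFun (hasSum_measureReal_singleton ν)
    (hasSum_measureReal_singleton_smul ν (h.integrable one_le_two))
    (hasSum_measureReal_singleton_smul ν h.integrable_sq).summable

end PGF

theorem tendsto_zero_of_rpow_mul {a L : ℝ} (ha : 0 < a) {f : ℕ → ℝ}
    (h : Tendsto (fun n : ℕ => (n : ℝ) ^ a * f n) atTop (𝓝 L)) : Tendsto f atTop (𝓝 0) := by
  have hinv := (tendsto_rpow_neg_atTop ha).comp tendsto_natCast_atTop_atTop
  have hprod := hinv.mul h
  rw [zero_mul] at hprod
  refine hprod.congr' ?_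
  filter_upwards [eventually_gt_atTop 0] with n hn
  have hn' : (0 : ℝ) < n := Nat.cast_pos.2 hn
  rw [Function.comp_apply, ← mul_assoc, ← Real.rpow_add hn', neg_add_cancel, Real.rpow_zero,
    one_mul]

theorem integral_pos_of_nonneg_of_pos {ν : Measure ℕ} {f : ℕ → ℝ} (hf : ∀ w, 0 ≤ f w)
    (hfi : Integrable f ν) {v : ℕ} (hν : ν {v} ≠ 0) (hv : 0 < f v) : 0 < ∫ w, f w ∂ν := by
  rw [integral_pos_iff_support_of_nonneg hf hfi]
  exact (pos_iff_ne_zero.2 hν).trans_le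
    (measure_mono (Set.singleton_subset_iff.2 (Function.mem_support.2 hv.ne')))

open scoped ComplexOrder in
theorem pgf_ofReal_pos {ν : Measure ℕ} [IsFiniteMeasure ν] (hν : ν {0} ≠ 0) {r : ℝ} (hr : 0 ≤ r)
    (hr1 : r ≤ 1) : 0 < pgf ν r := by
  have hint : Integrable (fun w => r ^ w) ν := integrable_of_forall_norm_le ν (D := 1) fun w => by
    rw [norm_pow, Real.norm_of_nonneg hr]
    exact pow_le_one₀ hr hr1
  have hpgf : pgf ν r = (∫ w, r ^ w ∂ν : ℝ) := by
    rw [← integral_pow_eq_pgf ν (by rwa [Complex.norm_real, Real.norm_of_nonneg hr]),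
      ← integral_complex_ofReal]
    simp only [Complex.ofReal_pow]
  rw [hpgf, Complex.zero_lt_real]
  exact integral_pos_of_nonneg_of_pos (fun w => pow_nonneg hr w) hint hν (by simp)

/-- `f` is harmonic at the states `v ≥ N` for the transition kernel `v ↦ κ v` on `ℕ`. Integrability
is required at every state, so that the integrals can be manipulated below level `N` as well. -/
structure IsHarmonicFrom (κ : ℕ → Measure ℕ) (N : ℕ) (f : ℕ → ℝ) : Prop where
  integrable : ∀ v, Integrable f (κ v)
  integral_eq : ∀ v, N ≤ v → ∫ w, f w ∂κ v = f v

namespace IsHarmonicFrom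

variable {κ : ℕ → Measure ℕ} {N : ℕ} {f g : ℕ → ℝ}

theorem add (hf : IsHarmonicFrom κ N f) (hg : IsHarmonicFrom κ N g) :
    IsHarmonicFrom κ N (f + g) where
  integrable v := (hf.integrable v).add (hg.integrable v)
  integral_eq v hv := by
    rw [integral_add' (hf.integrable v) (hg.integrable v), hf.integral_eq v hv,
      hg.integral_eq v hv, Pi.add_apply]

theorem const_smul (hf : IsHarmonicFrom κ N f) (c : ℝ) : IsHarmonicFrom κ N (c • f) where
  integrable v := (hf.integrable v).smul c
  integral_eq v hv := by
    simp only [Pi.smul_apply, integral_smul, hf.integral_eq v hv]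

theorem le_zero_of_tendsto [∀ v, IsProbabilityMeasure (κ v)] (hκ : ∀ v, κ v {0} ≠ 0)
    (hf : IsHarmonicFrom κ N f) (hlim : Tendsto f atTop (𝓝 0)) (hN : 0 < N)
    (hbelow : ∀ v < N, f v ≤ 0) (v : ℕ) : f v ≤ 0 := by
  by_contra! hv
  obtain ⟨x, hmax⟩ : ∃ x, ∀ w, f w ≤ f x :=
    continuous_of_discreteTopology.exists_forall_ge' v <| by
      rw [cocompact_eq_cofinite, Nat.cofinite_eq_atTop]
      exact (hlim.eventually_lt_const hv).mono fun w hw => hw.le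
  have hxpos : 0 < f x := hv.trans_le (hmax v)
  have hNx : N ≤ x := not_lt.1 fun hx => (hbelow x hx).not_gt hxpos
  have hpos : 0 < ∫ w, (f x - f w) ∂κ x :=
    integral_pos_of_nonneg_of_pos (fun w => sub_nonneg.2 (hmax w))
      ((integrable_const _).sub (hf.integrable x)) (hκ x)
      (sub_pos.2 ((hbelow 0 hN).trans_lt hxpos))
  rw [integral_sub (integrable_const _) (hf.integrable x), hf.integral_eq x hNx] at hpos
  simp at hpos

end IsHarmonicFrom

/-- The functions on `ℕ` that are harmonic for `κ` from level `N` on and for which `n^a f(n)`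
converges as `n → ∞`. -/
def regularHarmonic (κ : ℕ → Measure ℕ) (N : ℕ) (a : ℝ) : Submodule ℝ (ℕ → ℝ) where
  carrier := {f | IsHarmonicFrom κ N f ∧
    ∃ L, Tendsto (fun n : ℕ => (n : ℝ) ^ a * f n) atTop (𝓝 L)}
  add_mem' := by
    rintro f g ⟨hf, L, hL⟩ ⟨hg, L', hL'⟩
    exact ⟨hf.add hg, _, (hL.add hL').congr fun n => (mul_add _ _ _).symm⟩
  zero_mem' := ⟨⟨fun _ => integrable_zero _ _ _, fun _ _ => integral_zero _ _⟩, 0, by simp⟩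
  smul_mem' := by
    rintro c f ⟨hf, L, hL⟩
    exact ⟨hf.const_smul c, _, (hL.const_mul c).congr fun n => mul_left_comm _ _ _⟩

/-- The linear system for the Dirichlet problem with boundary `{0}`: a function that is harmonic
from level `M` on vanishes under `boundaryDefect` if and only if it vanishes at `0` and is harmonic
at every `v > 0`. -/
def boundaryDefect (κ : ℕ → Measure ℕ) (M : ℕ) (a : ℝ) :
    regularHarmonic κ M a →ₗ[ℝ] Fin M → ℝ where
  toFun f v := if (v : ℕ) = 0 then f.1 0 else f.1 v - ∫ w, f.1 w ∂κ v
  map_add' f g := by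
    ext v
    have h := integral_add' (f.2.1.integrable v) (g.2.1.integrable v)
    simp only [Submodule.coe_add, Pi.add_apply] at h ⊢
    split_ifs
    · rfl
    · rw [h]
      ring
  map_smul' c f := by
    ext v
    simp only [Submodule.coe_smul, Pi.smul_apply, smul_eq_mul, integral_const_mul,
      RingHom.id_apply, mul_ite, mul_sub]

theorem isHarmonicFrom_one_of_boundaryDefect {κ : ℕ → Measure ℕ} {M : ℕ} {a : ℝ}
    {f : regularHarmonic κ M a} (h : ∀ v : Fin M, 0 < (v : ℕ) → boundaryDefect κ M a f v = 0) :
    IsHarmonicFrom κ 1 f.1 where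
  integrable := f.2.1.integrable
  integral_eq v hv := by
    rcases lt_or_ge v M with hvM | hvM
    · have hdefect := h ⟨v, hvM⟩ hv
      rw [boundaryDefect, LinearMap.coe_mk, AddHom.coe_mk, if_neg (Nat.ne_of_gt hv)] at hdefect
      exact (sub_eq_zero.1 hdefect).symm
    · exact f.2.1.integral_eq v hvM

section MaximumPrinciple

variable {κ : ℕ → Measure ℕ} [∀ v, IsProbabilityMeasure (κ v)] {M : ℕ} {f g : ℕ → ℝ} {a : ℝ}

theorem IsHarmonicFrom.nonneg_of_tendsto (hκ : ∀ v, κ v {0} ≠ 0) (hf : IsHarmonicFrom κ M f)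
    (hlim : Tendsto f atTop (𝓝 0)) (hM : 0 < M) (hbelow : ∀ v < M, 0 ≤ f v) (v : ℕ) :
    0 ≤ f v := by
  have hneg : Tendsto (fun v => (-1 : ℝ) • f v) atTop (𝓝 0) := by simpa using hlim.neg
  have h := (hf.const_smul (-1)).le_zero_of_tendsto hκ hneg hM
    (fun v hv => by simpa using hbelow v hv) v
  simpa using h

theorem IsHarmonicFrom.pos_of_tendsto (hκ : ∀ v, κ v {0} ≠ 0) (hf : IsHarmonicFrom κ 1 f)
    (hlim : Tendsto f atTop (𝓝 0)) (h0 : 0 < f 0) (v : ℕ) : 0 < f v := by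
  have hnonneg := hf.nonneg_of_tendsto hκ hlim one_pos fun v hv => by
    rw [Nat.lt_one_iff.1 hv]
    exact h0.le
  rcases Nat.eq_zero_or_pos v with rfl | hv
  · exact h0
  · rw [← hf.integral_eq v hv]
    exact integral_pos_of_nonneg_of_pos hnonneg (hf.integrable v) (hκ v) h0

theorem IsHarmonicFrom.exists_pos_mul_le (hκ : ∀ v, κ v {0} ≠ 0) (hf : IsHarmonicFrom κ M f)
    (hg : IsHarmonicFrom κ M g) (hflim : Tendsto f atTop (𝓝 0)) (hglim : Tendsto g atTop (𝓝 0))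
    (hM : 0 < M) (hpos : ∀ v < M, 0 < f v) : ∃ ε > 0, ∀ v, ε * g v ≤ f v := by
  have hsmall : ∀ᶠ ε in 𝓝[>] (0 : ℝ), ∀ v ∈ Finset.range M, ε * g v < f v := by
    refine (Finset.eventually_all _).2 fun v hv => nhdsWithin_le_nhds ?_
    have hcont : Tendsto (fun ε : ℝ => ε * g v) (𝓝 0) (𝓝 (0 * g v)) := tendsto_id.mul_const _
    exact hcont.eventually_lt_const (by simpa using hpos v (Finset.mem_range.1 hv))
  obtain ⟨ε, hε, hε0⟩ := (hsmall.and self_mem_nhdsWithin).exists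
  refine ⟨ε, hε0, fun v => ?_⟩
  have hlim : Tendsto (fun v => f v + -ε • g v) atTop (𝓝 0) := by
    simpa using hflim.add (hglim.const_smul (-ε))
  have h := (hf.add (hg.const_smul (-ε))).nonneg_of_tendsto hκ hlim hM
    (fun v hv => by simpa using (hε v (Finset.mem_range.2 hv)).le) v
  simpa using h

theorem injective_boundaryDefect (hκ : ∀ v, κ v {0} ≠ 0) (hM : 0 < M) (ha : 0 < a) :
    Function.Injective (boundaryDefect κ M a) := by
  refine (injective_iff_map_eq_zero _).2 fun f hf => ?_
  obtain ⟨_, hL⟩ := f.2.2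
  have hlim := tendsto_zero_of_rpow_mul ha hL
  have hharm := isHarmonicFrom_one_of_boundaryDefect fun v _ => congrFun hf v
  have hf0 : ∀ v < 1, f.1 v = 0 := fun v hv => by
    simpa [Nat.lt_one_iff.1 hv, boundaryDefect] using congrFun hf ⟨0, hM⟩
  exact Subtype.ext <| funext fun v => le_antisymm
    (hharm.le_zero_of_tendsto hκ hlim one_pos (fun v hv => (hf0 v hv).le) v)
    (hharm.nonneg_of_tendsto hκ hlim one_pos (fun v hv => (hf0 v hv).ge) v)

end MaximumPrinciple

/-- A transition kernel on `ℕ` that can always jump to `0` and in which the individuals from number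
`M` on have independent geometric offspring of mean `1`: the row of `v ≥ M` has the generating
function `G z * f(z)^v` with `f = geomPGF`. The factor `G` has drift `δ`. -/
structure IsGeometricBranching (κ : ℕ → Measure ℕ) (M : ℕ) (G : ℂ → ℂ) (δ : ℝ) : Prop where
  isProbabilityMeasure : ∀ v, IsProbabilityMeasure (κ v)
  apply_zero_ne_zero : ∀ v, κ v {0} ≠ 0
  hasDriftExpansion : HasDriftExpansion G δ
  pgf_eq : ∀ v, M ≤ v → ∀ z, ‖z‖ ≤ 1 → pgf (κ v) z = G z * geomPGF z ^ v

namespace IsGeometricBranching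

variable {κ : ℕ → Measure ℕ} {M : ℕ} {G : ℂ → ℂ} {δ : ℝ}

theorem mul_geomPGF_pow_eq (hκ : IsGeometricBranching κ M G δ) {z : ℂ} (hz : ‖z‖ ≤ 1) {v : ℕ}
    (hv : v ≤ M) : G z * geomPGF z ^ v = pgf (κ M) z * (2 - z) ^ (M - v) := by
  have h2 := two_sub_ne_zero_of_norm_le_one hz
  rw [hκ.pgf_eq M le_rfl z hz, mul_assoc, ← Nat.sub_add_cancel hv, pow_add,
    Nat.add_sub_cancel, mul_right_comm, ← mul_assoc, geomPGF, ← mul_pow, inv_mul_cancel₀ h2,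
    one_pow, mul_one]

theorem continuousOn (hκ : IsGeometricBranching κ M G δ) : ContinuousOn G (closedBall 0 1) := by
  have := hκ.isProbabilityMeasure M
  refine ((continuousOn_genFun (hasSum_measureReal_singleton (κ M)).summable).mul
    (g := fun z => (2 - z) ^ M) (by fun_prop)).congr fun z hz => ?_
  simpa [pgf] using hκ.mul_geomPGF_pow_eq (mem_closedBall_zero_iff.1 hz) M.zero_le

open scoped ComplexOrder in
theorem ofReal_pos (hκ : IsGeometricBranching κ M G δ) {r : ℝ} (hr : 0 ≤ r) (hr1 : r ≤ 1) :
    0 < G r := by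
  have := hκ.isProbabilityMeasure M
  have hG := hκ.mul_geomPGF_pow_eq (z := r) (by rwa [Complex.norm_real, Real.norm_of_nonneg hr])
    M.zero_le
  rw [pow_zero, mul_one] at hG
  rw [hG]
  refine mul_pos (pgf_ofReal_pos (hκ.apply_zero_ne_zero M) hr hr1) ?_
  exact_mod_cast pow_pos (show 0 < 2 - r by linarith) (M - 0)

theorem greenCoeff_mem_regularHarmonic (hκ : IsGeometricBranching κ M G δ) (hδ : 1 < δ) {j : ℕ}
    (hj : j < M) : greenCoeff G j ∈ regularHarmonic κ M (δ - 1) := by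
  have := hκ.isProbabilityMeasure
  obtain ⟨L, hL⟩ := exists_tendsto_rpow_mul_greenCoeff hδ hκ.hasDriftExpansion hκ.continuousOn j
  have hint (v : ℕ) : Integrable (greenCoeff G j) (κ v) :=
    integrable_of_tendsto_atTop _ (tendsto_zero_of_rpow_mul (sub_pos.2 hδ) hL)
  refine ⟨⟨hint, fun v hv => ?_⟩, L, hL⟩
  have hgreen := hasSum_mul_greenCoeff hδ hκ.hasDriftExpansion hκ.continuousOn
    (hasSum_measureReal_singleton (κ v)).summable (hκ.pgf_eq v hv) j
  rw [(hasSum_measureReal_singleton_smul _ (hint v)).unique hgreen,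
    if_neg (hj.trans_le hv).ne', sub_zero]

theorem isHarmonicFrom_re_greenSeries_zero (hκ : IsGeometricBranching κ M G δ) (hδ : 1 < δ)
    (hM : 0 < M) : IsHarmonicFrom κ M fun n => (greenSeries G n 0).re := by
  have := hκ.isProbabilityMeasure
  obtain ⟨D, hD⟩ := exists_norm_greenSeries_le hδ hκ.hasDriftExpansion
  have hint (v : ℕ) : Integrable (fun n => (greenSeries G n 0).re) (κ v) :=
    integrable_of_forall_norm_le _ fun n =>
      (Complex.abs_re_le_norm _).trans (hD 0 (by norm_num) n)
  refine ⟨hint, fun v hv => ?_⟩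
  have hgreen := hasSum_mul_greenSeries hδ hκ.hasDriftExpansion
    (hasSum_measureReal_singleton (κ v)).summable (hκ.pgf_eq v hv) (s := 0) (by norm_num)
  rw [zero_pow (hM.trans_le hv).ne', sub_zero] at hgreen
  refine (hasSum_measureReal_singleton_smul _ (hint v)).unique ?_
  simpa only [Complex.re_ofReal_mul, smul_eq_mul] using Complex.hasSum_re hgreen

theorem linearIndependent_greenCoeff (hκ : IsGeometricBranching κ M G δ) (hδ : 1 < δ) :
    LinearIndependent ℝ fun j : Fin M => greenCoeff G j := by
  have := hκ.isProbabilityMeasure M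
  refine Fintype.linearIndependent_iff.2 fun c hc v => ?_
  -- Signed weights extend the Green equation below level `M`; integrating `hc` isolates `c v`.
  obtain ⟨b, hb, hgf⟩ := exists_genFun_eq_mul_two_sub_pow
    (hasSum_measureReal_singleton (κ M)).summable (M - v)
  have hgreen (j : Fin M) : HasSum (fun w => b w * greenCoeff G j w)
      (greenCoeff G j v - if (v : ℕ) = j then 1 else 0) :=
    hasSum_mul_greenCoeff hδ hκ.hasDriftExpansion hκ.continuousOn hb
      (fun z hz => (hgf z hz).trans (hκ.mul_geomPGF_pow_eq hz v.2.le).symm) j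
  have hc0 (w : ℕ) : ∑ j, c j * greenCoeff G j w = 0 := by simpa using congrFun hc w
  have hsum := hasSum_sum fun j (_ : j ∈ Finset.univ) => (hgreen j).mul_left (c j)
  simp only [mul_left_comm (c _), ← Finset.mul_sum, hc0, mul_zero, mul_sub,
    Finset.sum_sub_distrib, Fin.val_inj, zero_sub] at hsum
  simpa using hsum.unique hasSum_zero

theorem surjective_boundaryDefect (hκ : IsGeometricBranching κ M G δ) (hδ : 1 < δ) (hM : 0 < M) :
    Function.Surjective (boundaryDefect κ M (δ - 1)) := by
  have := hκ.isProbabilityMeasure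
  let W (j : Fin M) : regularHarmonic κ M (δ - 1) :=
    ⟨greenCoeff G j, hκ.greenCoeff_mem_regularHarmonic hδ j.2⟩
  have hW : LinearIndependent ℝ W :=
    .of_comp (Submodule.subtype _) (hκ.linearIndependent_greenCoeff hδ)
  have hinj : Function.Injective (boundaryDefect κ M (δ - 1) ∘ₗ Fintype.linearCombination ℝ W) :=
    (injective_boundaryDefect hκ.apply_zero_ne_zero hM (sub_pos.2 hδ)).comp
      hW.fintypeLinearCombination_injective
  exact .of_comp (LinearMap.injective_iff_surjective.1 hinj)

theorem exists_isHarmonicFrom_one (hκ : IsGeometricBranching κ M G δ) (hδ : 1 < δ) (hM : 0 < M) :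
    ∃ u : ℕ → ℝ, u 0 = 1 ∧ IsHarmonicFrom κ 1 u ∧
      ∃ c > 0, Tendsto (fun n : ℕ => (n : ℝ) ^ (δ - 1) * u n) atTop (𝓝 c) := by
  have := hκ.isProbabilityMeasure
  obtain ⟨u, hu⟩ := hκ.surjective_boundaryDefect hδ hM (Pi.single ⟨0, hM⟩ 1)
  have hu0 : u.1 0 = 1 := by simpa [boundaryDefect] using congrFun hu ⟨0, hM⟩
  have hharm : IsHarmonicFrom κ 1 u.1 := isHarmonicFrom_one_of_boundaryDefect fun v hv => by
    rw [hu, Pi.single_eq_of_ne (Fin.ne_of_gt hv)]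
  obtain ⟨c, hc⟩ := u.2.2
  have hlim := tendsto_zero_of_rpow_mul (sub_pos.2 hδ) hc
  have hpos := hharm.pos_of_tendsto hκ.apply_zero_ne_zero hlim (hu0.symm ▸ one_pos)
  obtain ⟨c', hc'0, hc'⟩ := exists_pos_tendsto_rpow_mul_re_greenSeries_zero hδ
    hκ.hasDriftExpansion fun r hr hr1 => hκ.ofReal_pos hr hr1.le
  obtain ⟨ε, hε0, hε⟩ := u.2.1.exists_pos_mul_le hκ.apply_zero_ne_zero
    (hκ.isHarmonicFrom_re_greenSeries_zero hδ hM) hlim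
    (tendsto_zero_of_rpow_mul (sub_pos.2 hδ) hc') hM fun v _ => hpos v
  refine ⟨u.1, hu0, hharm, c, (mul_pos hε0 hc'0).trans_le ?_, hc⟩
  refine le_of_tendsto_of_tendsto' (hc'.const_mul ε) hc fun n => ?_
  rw [mul_left_comm]
  exact mul_le_mul_of_nonneg_left (hε n) (by positivity)

end IsGeometricBranching

section IntegralLimit

variable {E ι : Type*} [NormedAddCommGroup E] [NormedSpace ℝ E] [CompleteSpace E]

theorem norm_integral_le_sum_range_add {ν : Measure ℕ} [IsProbabilityMeasure ν] {f : ℕ → E}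
    (hf : Integrable f ν) {K : ℕ} {ε : ℝ} (hε : 0 ≤ ε) (hK : ∀ v, K ≤ v → ‖f v‖ ≤ ε) :
    ‖∫ v, f v ∂ν‖ ≤ ∑ v ∈ Finset.range K, ‖ν.real {v} • f v‖ + ε := by
  have hhead : ∫ v in (Finset.range K : Set ℕ), f v ∂ν =
      ∑ v ∈ Finset.range K, ν.real {v} • f v := setIntegral_finset _ hf.integrableOn
  have htail : ‖∫ v in (Finset.range K : Set ℕ)ᶜ, f v ∂ν‖ ≤ ε := by
    refine (norm_setIntegral_le_of_norm_le_const (measure_lt_top _ _) fun v hv => hK v ?_).trans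
      (mul_le_of_le_one_right hε measureReal_le_one)
    simpa using hv
  rw [← integral_add_compl (Finset.range K).measurableSet hf, hhead]
  exact (norm_add_le _ _).trans (add_le_add (norm_sum_le _ _) htail)

theorem tendsto_integral_zero_of_tendsto_singleton {ν : ι → Measure ℕ}
    [∀ k, IsProbabilityMeasure (ν k)] {l : Filter ι} {f : ℕ → E} (hf : Tendsto f atTop (𝓝 0))
    (h : ∀ v, Tendsto (fun k => (ν k).real {v} • f v) l (𝓝 0)) :
    Tendsto (fun k => ∫ v, f v ∂ν k) l (𝓝 0) := by
  refine NormedAddGroup.tendsto_nhds_zero.2 fun ε hε => ?_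
  obtain ⟨K, hK⟩ := eventually_atTop.1
    (NormedAddGroup.tendsto_nhds_zero.1 hf (ε / 2) (half_pos hε))
  have hsum : Tendsto (fun k => ∑ v ∈ Finset.range K, ‖(ν k).real {v} • f v‖) l (𝓝 0) := by
    simpa using tendsto_finsetSum (Finset.range K) fun v _ => (h v).norm
  filter_upwards [hsum.eventually_lt_const (half_pos hε)] with k hk
  have hle := norm_integral_le_sum_range_add (integrable_of_tendsto_atTop (ν k) hf)
    (half_pos hε).le fun v hv => (hK v hv).le
  linarith

end IntegralLimit

theorem pgf_zero (ν : Measure ℕ) : pgf ν 0 = ν.real {0} := by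
  rw [pgf, genFun, tsum_eq_single 0 fun w hw => by rw [zero_pow hw, mul_zero], pow_zero, mul_one]

theorem pgf_conv (ν ρ : Measure ℕ) [IsFiniteMeasure ν] [IsFiniteMeasure ρ] {z : ℂ}
    (hz : ‖z‖ ≤ 1) : pgf (ν.conv ρ) z = pgf ν z * pgf ρ z := by
  have hint := integrable_of_forall_norm_le (ν.conv ρ) (norm_pow_le_one_of_norm_le_one hz)
  rw [← integral_pow_eq_pgf _ hz, ← integral_pow_eq_pgf _ hz, ← integral_pow_eq_pgf _ hz,
    integral_conv hint]
  simp only [pow_add, integral_const_mul, integral_mul_const]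

theorem pgf_geometricMeasure {p : unitInterval} (hp : p ≠ 0) {z : ℂ} (hz : ‖z‖ ≤ 1) :
    pgf (geometricMeasure p) z = (1 - (1 - (p : ℝ)) * z)⁻¹ * (p : ℝ) := by
  have hp' : (0 : ℝ) < p := unitInterval.pos_iff_ne_zero.2 hp
  have hratio : ‖(1 - (p : ℝ)) * z‖ < 1 := by
    rw [norm_mul, ← Complex.ofReal_one, ← Complex.ofReal_sub, Complex.norm_real,
      Real.norm_of_nonneg (sub_nonneg.2 p.2.2)]
    nlinarith [p.2.2, norm_nonneg z]
  have hsum := (hasSum_geometric_of_norm_lt_one hratio).mul_right ((p : ℝ) : ℂ)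
  rw [← hsum.tsum_eq, pgf, genFun]
  refine tsum_congr fun w => ?_
  rw [geometricMeasure_real_singleton hp, mul_pow]
  push_cast
  ring

theorem pgf_geometricMeasure_halfParam {z : ℂ} (hz : ‖z‖ ≤ 1) :
    pgf (geometricMeasure halfParam) z = geomPGF z := by
  have hp : halfParam ≠ 0 := fun h => by simpa [halfParam] using congrArg Subtype.val h
  rw [pgf_geometricMeasure hp hz, geomPGF, halfParam]
  have h2 := two_sub_ne_zero_of_norm_le_one hz
  have h : 1 - (1 - ((1 / 2 : ℝ) : ℂ)) * z = (2 - z) / 2 := by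
    push_cast
    ring
  rw [h]
  push_cast
  field_simp

theorem measurable_sum_range (v : ℕ) :
    Measurable fun x : ℕ → ℕ => ∑ m ∈ Finset.range v, x m :=
  Finset.measurable_fun_sum _ fun m _ => measurable_pi_apply m

theorem measurable_sum_range_fst :
    Measurable fun p : ℕ × (ℕ → ℕ) => ∑ m ∈ Finset.range p.1, p.2 m :=
  measurable_from_prod_countable_right measurable_sum_range

/-- The number of children of the first `v` individuals of generation `k`. -/
def offspringSum {Ω : Type*} (ξ : ℕ → ℕ → Ω → ℕ) (k v : ℕ) (ω : Ω) : ℕ :=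
  ∑ m ∈ Finset.range v, ξ k m ω

/-- The transition law of the forward branching process at the state `v`: the law of the number of
children of `v` individuals, read off from generation `0`. -/
def offspringLaw {Ω : Type*} [MeasurableSpace Ω] (μ : Measure Ω) (ξ : ℕ → ℕ → Ω → ℕ) (v : ℕ) :
    Measure ℕ :=
  μ.map (offspringSum ξ 0 v)

/-- The generation to which the random quantity with the given index in `offspringSigma` belongs. -/
def offspringGeneration : ℕ ⊕ (ℕ × ℕ) → ℕ := Sum.elim id Prod.fst

section SigmaAlgebras

variable {Ω : Type*} {M : ℕ} {ξ : ℕ → ℕ → Ω → ℕ}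

theorem offspringSum_succ (k v : ℕ) :
    offspringSum ξ k (v + 1) = offspringSum ξ k v + ξ k v := by
  ext ω
  simp [offspringSum, Finset.sum_range_succ]

theorem forwardBP_succ_eq_zero {n k : ℕ} {ω : Ω} (h : forwardBP ξ n k ω = 0) :
    forwardBP ξ n (k + 1) ω = 0 := by
  rw [forwardBP, h, Finset.range_zero, Finset.sum_empty]

theorem entranceTime_zero_lt_top_iff {f : ℕ → ℕ} : entranceTime f 0 < ⊤ ↔ ∃ k, f k = 0 := by
  simp [entranceTime, iInf_lt_iff]

theorem measurable_offspring_iSup {S : Set (ℕ ⊕ (ℕ × ℕ))} {k m : ℕ}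
    (hfirst : m < M → Sum.inl k ∈ S) (hlater : ∀ j, m = M + j → Sum.inr (k, j) ∈ S) :
    Measurable[⨆ i ∈ S, offspringSigma M ξ i] (ξ k m) := by
  rcases lt_or_ge m M with hm | hm
  · have h : Measurable[offspringSigma M ξ (Sum.inl k)] (ξ k m) :=
      (measurable_pi_apply (⟨m, hm⟩ : Fin M)).comp (comap_measurable (firstOffspring M ξ k))
    exact h.mono (le_iSup₂_of_le _ (hfirst hm) le_rfl) le_rfl
  · obtain ⟨j, rfl⟩ := Nat.exists_eq_add_of_le hm
    have h : Measurable[offspringSigma M ξ (Sum.inr (k, j))] (ξ k (M + j)) := comap_measurable _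
    exact h.mono (le_iSup₂_of_le _ (hlater j rfl) le_rfl) le_rfl

theorem measurable_generation_iSup {S : Set (ℕ ⊕ (ℕ × ℕ))} {k : ℕ}
    (hS : ∀ i, offspringGeneration i = k → i ∈ S) :
    Measurable[⨆ i ∈ S, offspringSigma M ξ i] fun ω m => ξ k m ω :=
  @measurable_pi_lambda _ _ _ (⨆ i ∈ S, offspringSigma M ξ i) _ _ fun _ =>
    measurable_offspring_iSup (fun _ => hS _ rfl) fun _ _ => hS _ rfl

theorem measurable_forwardBP_iSup (n k : ℕ) :
    Measurable[⨆ i ∈ {i | offspringGeneration i < k}, offspringSigma M ξ i] (forwardBP ξ n k) := by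
  induction k with
  | zero => exact measurable_const
  | succ k ih =>
    have hpast := ih.mono (biSup_mono fun i hi => lt_trans hi k.lt_succ_self) le_rfl
    have hlast : Measurable[⨆ i ∈ {i | offspringGeneration i < k + 1}, offspringSigma M ξ i]
        fun ω m => ξ k m ω :=
      measurable_generation_iSup fun i hi => hi.trans_lt k.lt_succ_self
    exact measurable_sum_range_fst.comp (hpast.prodMk hlast)

end SigmaAlgebras

/-- The assumptions of `IsForwardOffspring` with the fourth moment weakened to a second moment,
stated as square integrability of the first `M` offspring variables. -/
structure IsSqIntegrableOffspring {Ω : Type*} [MeasurableSpace Ω] (μ : Measure Ω) (M : ℕ)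
    (ξ : ℕ → ℕ → Ω → ℕ) : Prop where
  measurable : ∀ k m, Measurable (ξ k m)
  indep : iIndep (offspringSigma M ξ) μ
  identDistrib : ∀ k, IdentDistrib (firstOffspring M ξ k) (firstOffspring M ξ 0) μ μ
  vanish_pos : 0 < μ {ω | firstOffspring M ξ 0 ω = 0}
  memLp_two : ∀ m < M, MemLp (fun ω => (ξ 0 m ω : ℝ)) 2 μ
  geometric : ∀ k m, M ≤ m → HasLaw (ξ k m) (geometricMeasure halfParam) μ

theorem IsForwardOffspring.isSqIntegrableOffspring {Ω : Type*} [MeasurableSpace Ω] {μ : Measure Ω}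
    {M : ℕ} {ξ : ℕ → ℕ → Ω → ℕ} (hξ : IsForwardOffspring μ M ξ) :
    IsSqIntegrableOffspring μ M ξ where
  measurable := hξ.measurable
  indep := hξ.indep
  identDistrib := hξ.identDistrib
  vanish_pos := hξ.vanish_pos
  geometric := hξ.geometric
  memLp_two m hm := by
    have hmeas : Measurable fun ω => (ξ 0 m ω : ℝ) :=
      Measurable.of_discrete.comp (hξ.measurable 0 m)
    refine (memLp_two_iff_integrable_sq hmeas.aestronglyMeasurable).2 <|
      (hξ.fourth_moment m hm).mono' (hmeas.pow_const 2).aestronglyMeasurable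
        (ae_of_all _ fun ω => ?_)
    have hpow : ξ 0 m ω ^ 2 ≤ ξ 0 m ω ^ 4 :=
      (Nat.le_self_pow two_ne_zero _).trans_eq (pow_mul _ 2 2).symm
    rw [Real.norm_of_nonneg (sq_nonneg _)]
    exact_mod_cast hpow

namespace IsSqIntegrableOffspring

variable {Ω : Type*} [mΩ : MeasurableSpace Ω] {μ : Measure Ω} {M : ℕ} {ξ : ℕ → ℕ → Ω → ℕ}

theorem measurable_offspringSum (hξ : IsSqIntegrableOffspring μ M ξ) (k v : ℕ) :
    Measurable (offspringSum ξ k v) :=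
  Finset.measurable_fun_sum _ fun m _ => hξ.measurable k m

theorem measurable_generation (hξ : IsSqIntegrableOffspring μ M ξ) (k : ℕ) :
    Measurable fun ω m => ξ k m ω :=
  measurable_pi_lambda _ (hξ.measurable k)

theorem measurable_forwardBP (hξ : IsSqIntegrableOffspring μ M ξ) (n k : ℕ) :
    Measurable (forwardBP ξ n k) := by
  induction k with
  | zero => exact measurable_const
  | succ k ih => exact measurable_sum_range_fst.comp (ih.prodMk (hξ.measurable_generation k))

theorem offspringSigma_le (hξ : IsSqIntegrableOffspring μ M ξ) :
    ∀ i, offspringSigma M ξ i ≤ mΩ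
  | .inl k => (measurable_pi_lambda _ fun m : Fin M => hξ.measurable k m).comap_le
  | .inr (k, j) => (hξ.measurable k (M + j)).comap_le

theorem indepFun_of_disjoint (hξ : IsSqIntegrableOffspring μ M ξ) {β γ : Type*}
    [MeasurableSpace β] [MeasurableSpace γ] {X : Ω → β} {Y : Ω → γ} {S T : Set (ℕ ⊕ (ℕ × ℕ))}
    (hST : Disjoint S T) (hX : Measurable[⨆ i ∈ S, offspringSigma M ξ i] X)
    (hY : Measurable[⨆ i ∈ T, offspringSigma M ξ i] Y) : IndepFun X Y μ :=
  indep_of_indep_of_le_left (indep_of_indep_of_le_right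
    (indep_iSup_of_disjoint hξ.offspringSigma_le hξ.indep hST) hY.comap_le) hX.comap_le

theorem indepFun_forwardBP_generation (hξ : IsSqIntegrableOffspring μ M ξ) (n k : ℕ) :
    IndepFun (forwardBP ξ n k) (fun ω m => ξ k m ω) μ :=
  hξ.indepFun_of_disjoint (T := {i | offspringGeneration i = k})
    (Set.disjoint_left.2 fun _ hlt heq => ne_of_lt hlt heq) (measurable_forwardBP_iSup n k)
    (measurable_generation_iSup fun _ hi => hi)

theorem indepFun_offspringSum (hξ : IsSqIntegrableOffspring μ M ξ) (k : ℕ) {v : ℕ} (hv : M ≤ v) :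
    IndepFun (offspringSum ξ k v) (ξ k v) μ := by
  obtain ⟨l, rfl⟩ := Nat.exists_eq_add_of_le hv
  refine hξ.indepFun_of_disjoint (S := {Sum.inr (k, l)}ᶜ) (T := {Sum.inr (k, l)})
    disjoint_compl_left ?_ ?_
  · refine Finset.measurable_fun_sum _ fun m hm =>
      measurable_offspring_iSup (fun _ => by simp) fun j hj => ?_
    have hjl : j < l := by simpa [hj] using hm
    simpa using hjl.ne
  · refine measurable_offspring_iSup (fun h => by omega) fun j hj => ?_
    rw [Nat.add_left_cancel hj, Set.mem_singleton_iff]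

theorem map_offspringSum_succ [IsFiniteMeasure μ] (hξ : IsSqIntegrableOffspring μ M ξ) (k : ℕ)
    {v : ℕ} (hv : M ≤ v) :
    μ.map (offspringSum ξ k (v + 1)) =
      (μ.map (offspringSum ξ k v)).conv (geometricMeasure halfParam) := by
  rw [offspringSum_succ, (hξ.indepFun_offspringSum k hv).map_add_eq_map_conv_map
    (hξ.measurable_offspringSum k v) (hξ.measurable k v), (hξ.geometric k v hv).map_eq]

theorem map_offspringSum [IsFiniteMeasure μ] (hξ : IsSqIntegrableOffspring μ M ξ) (k v : ℕ) :
    μ.map (offspringSum ξ k v) = offspringLaw μ ξ v := by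
  have hfirst {v : ℕ} (hv : v ≤ M) : μ.map (offspringSum ξ k v) = offspringLaw μ ξ v := by
    have hsum (k : ℕ) : offspringSum ξ k v =
        (fun x : Fin M → ℕ => ∑ m : Fin v, x (Fin.castLE hv m)) ∘ firstOffspring M ξ k := by
      ext ω
      simp [offspringSum, firstOffspring, Finset.sum_range]
    rw [offspringLaw, hsum k, hsum 0]
    exact ((hξ.identDistrib k).comp Measurable.of_discrete).map_eq
  rcases le_total v M with hv | hv
  · exact hfirst hv
  · induction v, hv using Nat.le_induction with
    | base => exact hfirst le_rfl
    | succ v hv ih =>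
      rw [offspringLaw, hξ.map_offspringSum_succ k hv, hξ.map_offspringSum_succ 0 hv, ih,
        offspringLaw]

theorem memLp_two_offspringLaw (hξ : IsSqIntegrableOffspring μ M ξ) :
    MemLp (fun w : ℕ => (w : ℝ)) 2 (offspringLaw μ ξ M) := by
  rw [offspringLaw, memLp_map_measure_iff Measurable.of_discrete.aestronglyMeasurable
    (hξ.measurable_offspringSum 0 M).aemeasurable]
  refine (memLp_finsetSum (Finset.range M) fun m hm =>
    hξ.memLp_two m (Finset.mem_range.1 hm)).ae_eq (ae_of_all _ fun ω => ?_)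
  simp [offspringSum]

section ProbabilityMeasure

variable [IsProbabilityMeasure μ]

theorem isProbabilityMeasure_offspringLaw (hξ : IsSqIntegrableOffspring μ M ξ) (v : ℕ) :
    IsProbabilityMeasure (offspringLaw μ ξ v) :=
  Measure.isProbabilityMeasure_map (hξ.measurable_offspringSum 0 v).aemeasurable

theorem pgf_offspringLaw (hξ : IsSqIntegrableOffspring μ M ξ) {v : ℕ} (hv : M ≤ v) {z : ℂ}
    (hz : ‖z‖ ≤ 1) :
    pgf (offspringLaw μ ξ v) z = pgf (offspringLaw μ ξ M) z * geomPGF z ^ (v - M) := by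
  have := hξ.isProbabilityMeasure_offspringLaw
  induction v, hv using Nat.le_induction with
  | base => rw [Nat.sub_self, pow_zero, mul_one]
  | succ v hv ih =>
    have hconv : offspringLaw μ ξ (v + 1) =
        (offspringLaw μ ξ v).conv (geometricMeasure halfParam) := hξ.map_offspringSum_succ 0 hv
    rw [hconv, pgf_conv _ _ hz, ih, pgf_geometricMeasure_halfParam hz, mul_assoc, ← pow_succ,
      Nat.succ_sub hv]

theorem offspringLaw_singleton_zero_ne_zero (hξ : IsSqIntegrableOffspring μ M ξ) (v : ℕ) :
    offspringLaw μ ξ v {0} ≠ 0 := by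
  have := hξ.isProbabilityMeasure_offspringLaw
  have hfirst {v : ℕ} (hv : v ≤ M) : offspringLaw μ ξ v {0} ≠ 0 := by
    rw [offspringLaw, Measure.map_apply (hξ.measurable_offspringSum 0 v) (.singleton 0)]
    refine (hξ.vanish_pos.trans_le (measure_mono fun ω hω => ?_)).ne'
    exact Finset.sum_eq_zero fun m hm =>
      congrFun hω ⟨m, (Finset.mem_range.1 hm).trans_le hv⟩
  rcases le_total v M with hv | hv
  · exact hfirst hv
  · have hpgf := hξ.pgf_offspringLaw hv (z := 0) (by simp)
    rw [pgf_zero, pgf_zero] at hpgf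
    have hM : (offspringLaw μ ξ M).real {0} ≠ 0 :=
      (measureReal_ne_zero_iff (by finiteness)).2 (hfirst le_rfl)
    have hreal : (offspringLaw μ ξ v).real {0} ≠ 0 := by
      rw [← Complex.ofReal_ne_zero, hpgf]
      exact mul_ne_zero (Complex.ofReal_ne_zero.2 hM) (pow_ne_zero _ (by simp [geomPGF]))
    exact (measureReal_ne_zero_iff (by finiteness)).1 hreal

theorem integral_offspringLaw (hξ : IsSqIntegrableOffspring μ M ξ) :
    ∫ w, (w : ℝ) ∂offspringLaw μ ξ M = driftParam μ M ξ + M := by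
  have hint (m : ℕ) (hm : m ∈ Finset.range M) : Integrable (fun ω => (ξ 0 m ω : ℝ) - 1) μ :=
    ((hξ.memLp_two m (Finset.mem_range.1 hm)).integrable one_le_two).sub (integrable_const _)
  have hsum (ω : Ω) : (offspringSum ξ 0 M ω : ℝ) =
      ∑ m ∈ Finset.range M, ((ξ 0 m ω : ℝ) - 1) + M := by
    simp [offspringSum]
  rw [offspringLaw, integral_map (hξ.measurable_offspringSum 0 M).aemeasurable
    Measurable.of_discrete.aestronglyMeasurable, driftParam]
  simp only [hsum]
  rw [integral_add (integrable_finsetSum _ hint) (integrable_const _)]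
  simp

theorem isGeometricBranching (hξ : IsSqIntegrableOffspring μ M ξ) :
    IsGeometricBranching (offspringLaw μ ξ) M (fun z => pgf (offspringLaw μ ξ M) z * (2 - z) ^ M)
      (driftParam μ M ξ) where
  isProbabilityMeasure := hξ.isProbabilityMeasure_offspringLaw
  apply_zero_ne_zero := hξ.offspringLaw_singleton_zero_ne_zero
  hasDriftExpansion := by
    have := hξ.isProbabilityMeasure_offspringLaw
    have h := (hasDriftExpansion_pgf _ hξ.memLp_two_offspringLaw).mul_two_sub_pow M
    rwa [hξ.integral_offspringLaw, add_sub_cancel_right] at h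
  pgf_eq v hv z hz := by
    have h2 := two_sub_ne_zero_of_norm_le_one hz
    rw [hξ.pgf_offspringLaw hv hz, mul_assoc, ← Nat.add_sub_cancel' hv, pow_add,
      ← mul_assoc (_ ^ M), geomPGF, ← mul_pow, mul_inv_cancel₀ h2, one_pow, one_mul,
      Nat.add_sub_cancel_left]

theorem map_forwardBP_succ (hξ : IsSqIntegrableOffspring μ M ξ) (n k : ℕ) :
    μ.map (forwardBP ξ n (k + 1)) =
      ((μ.map (forwardBP ξ n k)).prod (μ.map fun ω m => ξ k m ω)).map
        fun p : ℕ × (ℕ → ℕ) => ∑ m ∈ Finset.range p.1, p.2 m := by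
  have hV := hξ.measurable_forwardBP n k
  have hX := hξ.measurable_generation k
  rw [← (indepFun_iff_map_prod_eq_prod_map_map hV.aemeasurable hX.aemeasurable).1
    (hξ.indepFun_forwardBP_generation n k), Measure.map_map measurable_sum_range_fst (hV.prodMk hX)]
  rfl

theorem offspringLaw_eq_map_generation (hξ : IsSqIntegrableOffspring μ M ξ) (k v : ℕ) :
    offspringLaw μ ξ v = (μ.map fun ω m => ξ k m ω).map fun x => ∑ m ∈ Finset.range v, x m := by
  rw [← hξ.map_offspringSum k v,
    Measure.map_map (measurable_sum_range v) (hξ.measurable_generation k)]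
  rfl

theorem integral_map_forwardBP_succ (hξ : IsSqIntegrableOffspring μ M ξ) (n k : ℕ) {φ : ℕ → ℝ}
    (hφ : Integrable φ (μ.map (forwardBP ξ n (k + 1)))) :
    ∫ w, φ w ∂μ.map (forwardBP ξ n (k + 1)) =
      ∫ v, ∫ w, φ w ∂offspringLaw μ ξ v ∂μ.map (forwardBP ξ n k) := by
  have hφm : StronglyMeasurable φ := .of_discrete
  have := Measure.isProbabilityMeasure_map (μ := μ) (hξ.measurable_forwardBP n k).aemeasurable
  have := Measure.isProbabilityMeasure_map (μ := μ) (hξ.measurable_generation k).aemeasurable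
  rw [hξ.map_forwardBP_succ n k] at hφ ⊢
  rw [integral_map measurable_sum_range_fst.aemeasurable hφm.aestronglyMeasurable]
  refine (integral_prod _ (hφ.comp_measurable measurable_sum_range_fst)).trans <|
    integral_congr_ae (ae_of_all _ fun v => ?_)
  simp only [hξ.offspringLaw_eq_map_generation k v, Function.comp_apply]
  rw [integral_map (measurable_sum_range v).aemeasurable hφm.aestronglyMeasurable]

theorem offspringLaw_zero : offspringLaw μ ξ 0 = Measure.dirac 0 := by
  have h : offspringSum ξ 0 0 = fun _ : Ω => 0 := rfl
  rw [offspringLaw, h, Measure.map_const, measure_univ, one_smul]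

theorem integral_map_forwardBP_of_isHarmonicFrom (hξ : IsSqIntegrableOffspring μ M ξ)
    {u : ℕ → ℝ} (hu : IsHarmonicFrom (offspringLaw μ ξ) 1 u) (hlim : Tendsto u atTop (𝓝 0))
    (n k : ℕ) : ∫ w, u w ∂μ.map (forwardBP ξ n k) = u n := by
  have hharm (v : ℕ) : ∫ w, u w ∂offspringLaw μ ξ v = u v := by
    rcases Nat.eq_zero_or_pos v with rfl | hv
    · rw [offspringLaw_zero, integral_dirac]
    · exact hu.integral_eq v hv
  induction k with
  | zero =>
    have hstart : forwardBP ξ n 0 = fun _ => n := rfl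
    rw [hstart, Measure.map_const, measure_univ, one_smul, integral_dirac]
  | succ k ih =>
    rw [hξ.integral_map_forwardBP_succ n k (integrable_of_tendsto_atTop _ hlim)]
    simpa only [hharm] using ih

theorem tendsto_map_forwardBP_zero (hξ : IsSqIntegrableOffspring μ M ξ) (n : ℕ) :
    Tendsto (fun k => (μ.map (forwardBP ξ n k)).real {0}) atTop (𝓝 (extinctionProb μ ξ n)) := by
  have hmono : Monotone fun k => {ω | forwardBP ξ n k ω = 0} :=
    monotone_nat_of_le_succ fun k ω hω => forwardBP_succ_eq_zero hω
  have hextinct : {ω | entranceTime (fun k => forwardBP ξ n k ω) 0 < ⊤} =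
      ⋃ k, {ω | forwardBP ξ n k ω = 0} := by
    ext ω
    simp [entranceTime_zero_lt_top_iff]
  rw [extinctionProb, hextinct]
  refine ((ENNReal.tendsto_toReal (by finiteness)).comp
    (tendsto_measure_iUnion_atTop hmono)).congr fun k => ?_
  rw [map_measureReal_apply (hξ.measurable_forwardBP n k) (.singleton 0)]
  rfl

theorem map_forwardBP_real_zero_add_le (hξ : IsSqIntegrableOffspring μ M ξ) (n k : ℕ) {v : ℕ}
    (hv : v ≠ 0) :
    (μ.map (forwardBP ξ n k)).real {0} +
        (μ.map (forwardBP ξ n k)).real {v} * (offspringLaw μ ξ v).real {0} ≤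
      (μ.map (forwardBP ξ n (k + 1))).real {0} := by
  have hV := hξ.measurable_forwardBP n k
  have hS := hξ.measurable_offspringSum k v
  have hindep : IndepFun (forwardBP ξ n k) (offspringSum ξ k v) μ :=
    (hξ.indepFun_forwardBP_generation n k).comp measurable_id (measurable_sum_range v)
  have hdie : (μ.map (forwardBP ξ n k)).real {v} * (offspringLaw μ ξ v).real {0} =
      μ.real (forwardBP ξ n k ⁻¹' {v} ∩ offspringSum ξ k v ⁻¹' {0}) := by
    rw [← hξ.map_offspringSum k v, map_measureReal_apply hV (.singleton v),
      map_measureReal_apply hS (.singleton 0),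
      measureReal_def, measureReal_def, measureReal_def,
      hindep.measure_inter_preimage_eq_mul _ _ (.singleton v) (.singleton 0), ENNReal.toReal_mul]
  have hdisj : Disjoint (forwardBP ξ n k ⁻¹' {0})
      (forwardBP ξ n k ⁻¹' {v} ∩ offspringSum ξ k v ⁻¹' {0}) :=
    Set.disjoint_left.2 fun ω h0 hω => hv (hω.1.symm.trans h0)
  rw [hdie, map_measureReal_apply hV (.singleton 0),
    map_measureReal_apply (hξ.measurable_forwardBP n (k + 1)) (.singleton 0),
    ← measureReal_union hdisj ((hV (.singleton v)).inter (hS (.singleton 0)))]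
  refine measureReal_mono (Set.union_subset (fun ω hω => forwardBP_succ_eq_zero hω) ?_)
  rintro ω ⟨rfl, hω⟩
  exact hω

theorem tendsto_map_forwardBP_singleton (hξ : IsSqIntegrableOffspring μ M ξ) (n : ℕ) {v : ℕ}
    (hv : v ≠ 0) :
    Tendsto (fun k => (μ.map (forwardBP ξ n k)).real {v}) atTop (𝓝 0) := by
  have := hξ.isProbabilityMeasure_offspringLaw
  have hq : 0 < (offspringLaw μ ξ v).real {0} :=
    measureReal_nonneg.lt_of_ne'
      ((measureReal_ne_zero_iff (by finiteness)).2 (hξ.offspringLaw_singleton_zero_ne_zero v))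
  have hlim := hξ.tendsto_map_forwardBP_zero n
  have hincr := (((tendsto_add_atTop_iff_nat 1).2 hlim).sub hlim).div_const
    ((offspringLaw μ ξ v).real {0})
  rw [sub_self, zero_div] at hincr
  refine squeeze_zero (fun k => measureReal_nonneg) (fun k => ?_) hincr
  rw [le_div_iff₀ hq, le_sub_iff_add_le']
  exact hξ.map_forwardBP_real_zero_add_le n k hv

theorem extinctionProb_eq_of_isHarmonicFrom (hξ : IsSqIntegrableOffspring μ M ξ) {u : ℕ → ℝ}
    (hu : IsHarmonicFrom (offspringLaw μ ξ) 1 u) (h0 : u 0 = 1) (hlim : Tendsto u atTop (𝓝 0))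
    (n : ℕ) : extinctionProb μ ξ n = u n := by
  let ν (k : ℕ) := μ.map (forwardBP ξ n k)
  have (k : ℕ) : IsProbabilityMeasure (ν k) :=
    Measure.isProbabilityMeasure_map (hξ.measurable_forwardBP n k).aemeasurable
  have hsplit (k : ℕ) : (ν k).real {0} = u n - ∫ w, Set.indicator {0}ᶜ u w ∂ν k := by
    rw [← hξ.integral_map_forwardBP_of_isHarmonicFrom hu hlim n k, integral_indicator .of_discrete,
      ← integral_add_compl (.singleton 0) (integrable_of_tendsto_atTop (ν k) hlim),
      integral_singleton, h0, smul_eq_mul, mul_one, add_sub_cancel_right]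
  have hescape : Tendsto (fun k => ∫ w, Set.indicator {0}ᶜ u w ∂ν k) atTop (𝓝 0) := by
    refine tendsto_integral_zero_of_tendsto_singleton (hlim.congr' ?_) fun v => ?_
    · filter_upwards [eventually_ne_atTop 0] with v hv
      simp [hv]
    · rcases eq_or_ne v 0 with rfl | hv
      · simp
      · simpa [hv] using (hξ.tendsto_map_forwardBP_singleton n hv).smul_const (u v)
  have hu_lim := hescape.const_sub (u n)
  simp only [← hsplit, sub_zero] at hu_lim
  exact tendsto_nhds_unique (hξ.tendsto_map_forwardBP_zero n) hu_lim

end ProbabilityMeasure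

end IsSqIntegrableOffspring

end

theorem mainTheorem6_general {Ω : Type*} [MeasurableSpace Ω] (μ : Measure Ω)
    [IsProbabilityMeasure μ] (M : ℕ) (ξ : ℕ → ℕ → Ω → ℕ) (hξ : IsSqIntegrableOffspring μ M ξ)
    (hδ : 1 < driftParam μ M ξ) :
    ∃ c : ℝ, 0 < c ∧
      Tendsto (fun n : ℕ => (n : ℝ) ^ (driftParam μ M ξ - 1) * extinctionProb μ ξ n)
        atTop (𝓝 c) := by
  have hM : 0 < M := by
    refine Nat.pos_of_ne_zero fun hM => ?_
    norm_num [driftParam, hM] at hδ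
  obtain ⟨u, hu0, hu, c, hc, hlim⟩ := hξ.isGeometricBranching.exists_isHarmonicFrom_one hδ hM
  have hextinct : extinctionProb μ ξ = u := funext <|
    hξ.extinctionProb_eq_of_isHarmonicFrom hu hu0 (tendsto_zero_of_rpow_mul (sub_pos.2 hδ) hlim)
  exact ⟨c, hc, by rwa [hextinct]⟩

theorem mainTheorem6 {Ω : Type*} [MeasurableSpace Ω] (μ : Measure Ω) [IsProbabilityMeasure μ]
    (M : ℕ) (ξ : ℕ → ℕ → Ω → ℕ) (hξ : IsForwardOffspring μ M ξ)
    (hδ : 1 < driftParam μ M ξ) :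
    ∃ c : ℝ, 0 < c ∧
      Tendsto (fun n : ℕ => (n : ℝ) ^ (driftParam μ M ξ - 1) * extinctionProb μ ξ n)
        atTop (𝓝 c) :=
  mainTheorem6_general μ M ξ hξ.isSqIntegrableOffspring hδ
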